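/- Let $R$ be a real closed field, $C=R[i]$ with $i^2=-1$, and identify $C$ with $R^2$. **Cauchy index.** For $P\in R[T]\setminus\{0\}$ and $x\in R$ write $P=(T-x)^{\mathrm{mult}_x(P)}P_x$ with $P_x(x)\neq 0$. For $P,Q\in R[T]\setminus\{0\}$ put $v=\mathrm{mult}_x(P)-\mathrm{mult}_x(Q)$ and $s=\mathrm{sign}(P_x(x)Q_x(x))$. If $v<0$, put $\mathrm{Ind}_x^+(P,Q)=\frac12 s$ and $\mathrm{Ind}_x^-(P,Q)=\frac12(-1)^{v}s$. If $v\ge 0$, or if $P=0$ or $Q=0$, both are $0$. Let $\mathrm{Ind}_x=\mathrm{Ind}_x^+-\mathrm{Ind}_x^-$. For $a<b$ let $$\mathrm{Ind}_a^b(P,Q)=\mathrm{Ind}_a^+(P,Q)+\sum_{x\in(a,b)}\mathrm{Ind}_x(P,Q)-\mathrm{Ind}_b^-(P,Q),$$ a sum with finitely many nonzero terms, and let $\mathrm{Ind}_b^a=-\mathrm{Ind}_a^b$, $\mathrm{Ind}_a^a=0$. **Winding numbers.** A rectangle is $\Gamma=[x_0,x_1]\times[y_0,y_1]\subset R^2$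 with $x_0<x_1$ and $y_0<y_1$. Every $F\in C[X,Y]$ is uniquely $F=F_{\rm re}+iF_{\rm im}$ with $F_{\rm re},F_{\rm im}\in R[X,Y]$; let $\overline F=F_{\rm re}-iF_{\rm im}$. Define $$\begin{aligned}w(F\,|\,\partial\Gamma)=\tfrac12\Big(&\mathrm{Ind}_{x_0}^{x_1}(F_{\rm re}(T,y_0),F_{\rm im}(T,y_0))+\mathrm{Ind}_{y_0}^{y_1}(F_{\rm re}(x_1,T),F_{\rm im}(x_1,T))\\&+\mathrm{Ind}_{x_1}^{x_0}(F_{\rm re}(T,y_1),F_{\rm im}(T,y_1))+\mathrm{Ind}_{y_1}^{y_0}(F_{\rm re}(x_0,T),F_{\rm im}(x_0,T))\Big),\end{aligned}$$ $$W(F\,|\,\partial\Gamma)=\tfrac12\big(w(F\,|\,\partial\Gamma)+w(iF\,|\,\partial\Gamma)\big).$$ Regard $C[Z]\subset C[X,Y]$ through $Z=X+iY$. For $F,G\in C[Z]$ with $G\ne0$ define $W(F/G\,|\,\partial\Gamma)=W(F\overline G\,|\,\partial\Gamma)$. **Theorem 1.3.** Let $f\in C(Z)\setminus\{0\}$ and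 let $\Gamma$ be a rectangle. For every representation $f=F/G$ with $F,G\in C[Z]$ and $G\neq 0$ (not necessarily coprime), $W(F/G\,|\,\partial\Gamma)$ equals the number of zeros of $f$ in $\Gamma$, counted with multiplicity, minus the number of poles of $f$ in $\Gamma$, counted with order, where each zero or pole in the interior of $\Gamma$ counts $1$, each one on an edge but not at a vertex counts $\frac12$, and each one at a vertex counts $\frac14$. No assumption is made about zeros or poles on $\partial\Gamma$. -/

import Mathlib

namespace RectWinding

/-! ### The Cauchy index of a pair of real polynomials -/

section CauchyIndex

open Polynomial

variable {R : Type*} [Field R] [LinearOrder R]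

/-- The valuation `mult_x(P) - mult_x(Q)` of `P / Q` at `x`, used for nonzero `P` and `Q` only. -/
noncomputable def valAt (P Q : R[X]) (x : R) : ℤ :=
  (P.rootMultiplicity x : ℤ) - (Q.rootMultiplicity x : ℤ)

/-- The polynomial `P_x` with `P = (X - x) ^ mult_x(P) * P_x`. -/
noncomputable def cofactorAt (P : R[X]) (x : R) : R[X] :=
  P /ₘ (X - C x) ^ P.rootMultiplicity x

/-- `sign (P_x(x) * Q_x(x))`, as a rational number. -/
noncomputable def leadSign (P Q : R[X]) (x : R) : ℚ :=
  ((SignType.sign ((cofactorAt P x).eval x * (cofactorAt Q x).eval x) : SignType) : ℚ)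

open Classical in
/-- `Ind_x^+ (P, Q)`. -/
noncomputable def indRight (P Q : R[X]) (x : R) : ℚ :=
  if P ≠ 0 ∧ Q ≠ 0 ∧ valAt P Q x < 0 then (1 / 2) * leadSign P Q x else 0

open Classical in
/-- `Ind_x^- (P, Q)`. -/
noncomputable def indLeft (P Q : R[X]) (x : R) : ℚ :=
  if P ≠ 0 ∧ Q ≠ 0 ∧ valAt P Q x < 0 then
    (1 / 2) * (-1) ^ valAt P Q x * leadSign P Q x
  else 0

/-- `Ind_x (P, Q)`, the Cauchy index at a point. -/
noncomputable def indAt (P Q : R[X]) (x : R) : ℚ :=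
  indRight P Q x - indLeft P Q x

/-- `Ind_a^b (P, Q)` in the case `a < b`. -/
noncomputable def indLT (P Q : R[X]) (a b : R) : ℚ :=
  indRight P Q a + ∑ᶠ x ∈ Set.Ioo a b, indAt P Q x - indLeft P Q b

/-- `Ind_a^b (P, Q)`, the Cauchy index on an interval, for arbitrary `a` and `b`. -/
noncomputable def ind (P Q : R[X]) (a b : R) : ℚ :=
  if a < b then indLT P Q a b else if b < a then -indLT P Q b a else 0

/-- The sum in `indLT` has only finitely many nonzero terms. -/
theorem finite_support_indAt (P Q : R[X]) : (Function.support (indAt P Q)).Finite := by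
  classical
  refine (Q.roots.toFinset.finite_toSet).subset fun x hx => ?_
  by_contra hne
  apply hx
  have h : ¬ (P ≠ 0 ∧ Q ≠ 0 ∧ valAt P Q x < 0) := by
    rintro ⟨-, hQ, hv⟩
    apply hne
    have : 0 < Q.rootMultiplicity x := by unfold valAt at hv; omega
    simpa [hQ] using (Polynomial.rootMultiplicity_pos hQ).1 this
  simp [indAt, indRight, indLeft, h]

end CauchyIndex

/-! ### The field `C = R[i]` and polynomials in two variables over it -/

section Complexification

/-- `R[i]`: pairs `re + im * i` with `i ^ 2 = -1`. -/
abbrev Cx (R : Type*) [Field R] : Type _ := QuadraticAlgebra R (-1) 0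

/-- `-1` is not a square in an ordered field; hence `Cx R` is a field. -/
instance fact_sq_ne (R : Type*) [Field R] [LinearOrder R] [IsStrictOrderedRing R] :
    Fact (∀ r : R, r ^ 2 ≠ -1 + 0 * r) :=
  ⟨fun r h => by nlinarith [sq_nonneg r]⟩

variable {R : Type*} [Field R]

/-- The imaginary unit `i`. -/
def imUnit : Cx R := ⟨0, 1⟩

/-- The polynomial `F_re` (the variables are `X = X 0` and `Y = X 1`). -/
noncomputable def rePart (F : MvPolynomial (Fin 2) (Cx R)) : MvPolynomial (Fin 2) R :=
  ∑ m ∈ F.support, MvPolynomial.monomial m (F.coeff m).re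

/-- The polynomial `F_im`. -/
noncomputable def imPart (F : MvPolynomial (Fin 2) (Cx R)) : MvPolynomial (Fin 2) R :=
  ∑ m ∈ F.support, MvPolynomial.monomial m (F.coeff m).im

theorem coeff_rePart (F : MvPolynomial (Fin 2) (Cx R)) (m : Fin 2 →₀ ℕ) :
    (rePart F).coeff m = (F.coeff m).re := by
  classical
  simp only [rePart, MvPolynomial.coeff_sum, MvPolynomial.coeff_monomial, Finset.sum_ite_eq']
  split_ifs with h
  · rfl
  · rw [MvPolynomial.notMem_support_iff.1 h]; rfl

theorem coeff_imPart (F : MvPolynomial (Fin 2) (Cx R)) (m : Fin 2 →₀ ℕ) :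
    (imPart F).coeff m = (F.coeff m).im := by
  classical
  simp only [imPart, MvPolynomial.coeff_sum, MvPolynomial.coeff_monomial, Finset.sum_ite_eq']
  split_ifs with h
  · rfl
  · rw [MvPolynomial.notMem_support_iff.1 h]; rfl

/-- The conjugate polynomial `F_re - i * F_im`. -/
noncomputable def conj (F : MvPolynomial (Fin 2) (Cx R)) : MvPolynomial (Fin 2) (Cx R) :=
  MvPolynomial.map (algebraMap R (Cx R)) (rePart F) -
    MvPolynomial.C imUnit * MvPolynomial.map (algebraMap R (Cx R)) (imPart F)

/-- The identity `F = F_re + i * F_im`. -/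
theorem eq_rePart_add_imPart (F : MvPolynomial (Fin 2) (Cx R)) :
    F = MvPolynomial.map (algebraMap R (Cx R)) (rePart F) +
      MvPolynomial.C imUnit * MvPolynomial.map (algebraMap R (Cx R)) (imPart F) := by
  ext m <;>
  simp [MvPolynomial.coeff_map, MvPolynomial.coeff_C_mul, coeff_rePart, coeff_imPart, imUnit]

/-- The inclusion of `C[Z]` in `C[X, Y]` given by `Z = X + i * Y`. -/
noncomputable def inclZ (F : Polynomial (Cx R)) : MvPolynomial (Fin 2) (Cx R) :=
  Polynomial.aeval (MvPolynomial.X 0 + MvPolynomial.C imUnit * MvPolynomial.X 1) F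

end Complexification

/-! ### Rectangles and winding numbers -/

/-- A rectangle `[x₀, x₁] × [y₀, y₁]` with `x₀ < x₁` and `y₀ < y₁`. -/
structure Rectangle (R : Type*) [LT R] where
  x₀ : R
  x₁ : R
  y₀ : R
  y₁ : R
  x_lt : x₀ < x₁
  y_lt : y₀ < y₁

section Winding

variable {R : Type*} [Field R] [LinearOrder R]

/-- The one-variable polynomial `P(T, y)`. -/
noncomputable def restrictHor (P : MvPolynomial (Fin 2) R) (y : R) : Polynomial R :=
  MvPolynomial.aeval ![Polynomial.X, Polynomial.C y] P

/-- The one-variable polynomial `P(x, T)`. -/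
noncomputable def restrictVert (P : MvPolynomial (Fin 2) R) (x : R) : Polynomial R :=
  MvPolynomial.aeval ![Polynomial.C x, Polynomial.X] P

/-- The winding number `w(F | ∂Γ)` of a polynomial `F` in `C[X, Y]`. -/
noncomputable def windOld (F : MvPolynomial (Fin 2) (Cx R)) (Γ : Rectangle R) : ℚ :=
  (1 / 2) *
    (ind (restrictHor (rePart F) Γ.y₀) (restrictHor (imPart F) Γ.y₀) Γ.x₀ Γ.x₁
      + ind (restrictVert (rePart F) Γ.x₁) (restrictVert (imPart F) Γ.x₁) Γ.y₀ Γ.y₁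
      + ind (restrictHor (rePart F) Γ.y₁) (restrictHor (imPart F) Γ.y₁) Γ.x₁ Γ.x₀
      + ind (restrictVert (rePart F) Γ.x₀) (restrictVert (imPart F) Γ.x₀) Γ.y₁ Γ.y₀)

/-- The new winding number `W(F | ∂Γ)` of a polynomial `F` in `C[X, Y]`. -/
noncomputable def windNew (F : MvPolynomial (Fin 2) (Cx R)) (Γ : Rectangle R) : ℚ :=
  (1 / 2) * (windOld F Γ + windOld (MvPolynomial.C imUnit * F) Γ)

/-- The new winding number `W(F / G | ∂Γ)` of a quotient, computed from a chosen numerator `F`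
and denominator `G`. -/
noncomputable def windNewQuot (F G : MvPolynomial (Fin 2) (Cx R)) (Γ : Rectangle R) : ℚ :=
  windNew (F * conj G) Γ

/-- The weight of a point of `C = R × R` with respect to `Γ`: `1` in the interior, `1 / 4` at a
vertex, `1 / 2` on an edge (vertices excluded), `0` outside. -/
def weight (Γ : Rectangle R) (z : Cx R) : ℚ :=
  if Γ.x₀ < z.re ∧ z.re < Γ.x₁ ∧ Γ.y₀ < z.im ∧ z.im < Γ.y₁ then 1
  else if (z.re = Γ.x₀ ∨ z.re = Γ.x₁) ∧ (z.im = Γ.y₀ ∨ z.im = Γ.y₁) then 1 / 4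
  else if Γ.x₀ ≤ z.re ∧ z.re ≤ Γ.x₁ ∧ Γ.y₀ ≤ z.im ∧ z.im ≤ Γ.y₁ then 1 / 2
  else 0

variable [IsStrictOrderedRing R]

/-- The weighted number of zeros of `f` in `Γ`, with multiplicity. The numerator and the
denominator of `f` are taken coprime. -/
noncomputable def zerosIn (f : RatFunc (Cx R)) (Γ : Rectangle R) : ℚ :=
  (f.num.roots.map (weight Γ)).sum

/-- The weighted number of poles of `f` in `Γ`, with order. -/
noncomputable def polesIn (f : RatFunc (Cx R)) (Γ : Rectangle R) : ℚ :=
  (f.denom.roots.map (weight Γ)).sum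

end Winding

end RectWinding

set_option linter.unusedSectionVars false

/-! Since iF has real and imaginary parts -F_im and F_re, and Ind(P,Q) + Ind(-Q,P) = Ind(P²-Q²,
2PQ), the number W(F) is a quarter of the Cauchy index of F² along the boundary
(`windNew_eq_boundaryIndex`). It remains to see that this index is additive under products and to
compute it for Z - z.

Additivity rests on a local product formula (`indSide_mul`): on either side of a point, Ind(zw) -
Ind(z) - Ind(w) plus half the sign there of im z · im w · im(zw) is a number independent of the
side. Summed over an interval, the signs telescope by the intermediate value property
(`sideSum_germSign`) and only endpoint terms remain (`indLT_mul`). Applied to squares, these terms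
do not change when the values are multiplied by nonzero reals or by i. That is exactly the
discrepancy between two adjacent edges at a vertex where F vanishes, so the terms cancel around the
rectangle (`boundaryIndex_mul`).

As F times its conjugate is real, conjugation changes the sign of the index. As R[i] is
algebraically closed, F splits into linear factors, and the index of Z - z is a product of two
one-dimensional counts (`boundaryIndex_X_sub_C`, `weight_eq`). -/

namespace RectWinding

/-! ### R[i] is algebraically closed -/

section AlgClosed

open Polynomial

/-- The minimal polynomial of a primitive element has odd degree, hence a root in R; being
irreducible, it is linear. -/
theorem finrank_eq_one_of_odd {R F : Type*} [Field R] [IsRealClosed R] [Field F] [CharZero R]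
    [Algebra R F] (h : Odd (Module.finrank R F)) : Module.finrank R F = 1 := by
  have : FiniteDimensional R F := Module.finite_of_finrank_pos h.pos
  obtain ⟨α, hα⟩ := Field.exists_primitive_element R F
  have hint : IsIntegral R α := IsIntegral.of_finite _ _
  have h1 : Module.finrank R F = (minpoly R α).natDegree := by
    rw [← IntermediateField.adjoin.finrank hint, hα, IntermediateField.finrank_top']
  obtain ⟨x, hx⟩ := IsRealClosed.exists_isRoot_of_odd_natDegree (h1 ▸ h)
  rw [h1]
  exact natDegree_eq_of_degree_eq_some
    (degree_eq_one_of_irreducible_of_root (minpoly.irreducible hint) hx)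

/-- The fixed field of a Sylow 2-subgroup has odd degree over R, hence degree 1, so the subgroup is
the whole group. -/
theorem card_galois_eq_two_pow (R K : Type*) [Field R] [IsRealClosed R] [Field K]
    [CharZero R] [Algebra R K] [FiniteDimensional R K] [IsGalois R K] : ∃ n, Nat.card Gal(K/R) = 2 ^ n := by
  have : Fact (Nat.Prime 2) := ⟨Nat.prime_two⟩
  let S : Sylow 2 Gal(K/R) := default
  have h1 : (S : Subgroup Gal(K/R)).index = 1 := by
    have h := IntermediateField.finrank_eq_fixingSubgroup_index K
      (IntermediateField.fixedField (S : Subgroup Gal(K/R)))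
    rw [IntermediateField.fixingSubgroup_fixedField] at h
    rw [← h]
    refine finrank_eq_one_of_odd ?_
    rw [h, ← Nat.not_even_iff_odd, even_iff_two_dvd]
    exact S.not_dvd_index
  obtain ⟨n, hn⟩ := S.isPGroup'.exists_card_eq
  refine ⟨n, ?_⟩
  rw [← hn, Subgroup.index_eq_one.1 h1]
  simp

variable {R : Type*} [Field R] [LinearOrder R] [IsStrictOrderedRing R] [IsRealClosed R]

/-- With r the modulus of a + bi, the root is x + yi with x² = (r + a)/2 and y² = (r - a)/2. Then
(2xy)² = b², which fixes the sign of y. -/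
theorem isSquare_cx (z : Cx R) : IsSquare z := by
  obtain ⟨a, b⟩ := z
  obtain ⟨r, hr0, hr⟩ : ∃ r : R, 0 ≤ r ∧ r * r = a ^ 2 + b ^ 2 := by
    obtain ⟨r, hr⟩ := IsSquare.of_nonneg (x := a ^ 2 + b ^ 2) (by positivity)
    exact ⟨|r|, abs_nonneg r, by rw [abs_mul_abs_self, hr]⟩
  have h1 : |a| ≤ r := abs_le_of_sq_le_sq (by nlinarith [sq_nonneg b]) hr0
  obtain ⟨h2, h3⟩ := abs_le.1 h1
  obtain ⟨x, hx⟩ := IsSquare.of_nonneg (x := (r + a) / 2) (by linarith)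
  obtain ⟨y, hy⟩ := IsSquare.of_nonneg (x := (r - a) / 2) (by linarith)
  have hxy : (2 * x * y) ^ 2 = b ^ 2 := by
    calc (2 * x * y) ^ 2 = 4 * (x * x) * (y * y) := by ring
      _ = b ^ 2 := by rw [← hx, ← hy]; linear_combination hr
  rcases sq_eq_sq_iff_eq_or_eq_neg.1 hxy with h | h
  · exact ⟨⟨x, y⟩, by ext <;> simp <;> [linear_combination hx - hy; linear_combination -h]⟩
  · exact ⟨⟨x, -y⟩, by ext <;> simp <;> [linear_combination hx - hy; linear_combination h]⟩

/-- Discriminants are squares, so the quadratic formula gives every polynomial of degree 1 or 2 a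
root. -/
theorem finrank_cx_ne_two {F : Type*} [Field F] [Algebra (Cx R) F] :
    Module.finrank (Cx R) F ≠ 2 := by
  intro h
  have : FiniteDimensional (Cx R) F := Module.finite_of_finrank_pos (by omega)
  obtain ⟨y, hy⟩ : ∃ y : F, y ∉ (algebraMap (Cx R) F).range := by
    by_contra! hall
    have : (⊥ : Subalgebra (Cx R) F) = ⊤ := by
      ext x
      simpa [Algebra.mem_bot] using hall x
    have := Subalgebra.bot_eq_top_iff_finrank_eq_one.1 this
    omega
  have hint : IsIntegral (Cx R) y := IsIntegral.of_finite _ _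
  have hdeg : (minpoly (Cx R) y).natDegree ≤ 2 := h ▸ minpoly.natDegree_le y
  obtain ⟨a, b, c, habc⟩ : ∃ a b c, minpoly (Cx R) y = C a * X ^ 2 + C b * X + C c :=
    ⟨_, _, _, Polynomial.eq_quadratic_of_degree_le_two (natDegree_le_iff_degree_le.1 hdeg)⟩
  have hroot : ∃ x, (minpoly (Cx R) y).IsRoot x := by
    by_cases ha : a = 0
    · subst ha
      have hb : b ≠ 0 := by
        rintro rfl
        have := minpoly.degree_pos hint
        rw [habc] at this
        simp only [map_zero, zero_mul, zero_add] at this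
        exact absurd (degree_C_le (a := c)) (not_le.2 this)
      exact ⟨-c / b, by simp [habc, IsRoot.def, mul_div_cancel₀ _ hb]⟩
    · have : NeZero (2 : Cx R) := ⟨two_ne_zero⟩
      obtain ⟨x, hx⟩ := exists_quadratic_eq_zero ha (isSquare_cx (discrim a b c))
      exact ⟨x, by simp only [habc, IsRoot.def, eval_add, eval_mul, eval_C,
        eval_X, pow_two]; exact hx⟩
  obtain ⟨x, hx⟩ := hroot
  have h1 := degree_eq_one_of_irreducible_of_root (minpoly.irreducible hint) hx
  exact hy (minpoly.mem_range_of_degree_eq_one _ _ h1)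

/-- The Galois group over R[i] is a 2-group. If it were nontrivial, a subgroup of index 2 would give
a quadratic extension of R[i]. -/
theorem finrank_cx_eq_one (K : Type*) [Field K] [Algebra (Cx R) K] [Algebra R K]
    [IsScalarTower R (Cx R) K] [FiniteDimensional R K] [IsGalois R K] :
    Module.finrank (Cx R) K = 1 := by
  have : Fact (Nat.Prime 2) := ⟨Nat.prime_two⟩
  have : IsGalois (Cx R) K := IsGalois.tower_top_of_isGalois R (Cx R) K
  have : FiniteDimensional (Cx R) K := FiniteDimensional.right R (Cx R) K
  obtain ⟨n, hn⟩ := card_galois_eq_two_pow R K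
  rw [IsGalois.card_aut_eq_finrank, ← Module.finrank_mul_finrank R (Cx R) K,
    QuadraticAlgebra.finrank_eq_two] at hn
  obtain ⟨m, -, hm⟩ := (Nat.dvd_prime_pow Nat.prime_two).1 (Dvd.intro_left _ hn)
  rcases m with _ | m
  · simpa using hm
  · exfalso
    have hcard : Nat.card Gal(K/Cx R) = 2 ^ (m + 1) := by
      rw [IsGalois.card_aut_eq_finrank, hm]
    obtain ⟨H, hH⟩ := Sylow.exists_subgroup_card_pow_prime (G := Gal(K/Cx R)) 2 (n := m)
      (hcard ▸ pow_dvd_pow 2 (Nat.le_succ m))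
    have h := IntermediateField.finrank_eq_fixingSubgroup_index K (IntermediateField.fixedField H)
    rw [IntermediateField.fixingSubgroup_fixedField] at h
    have h2 := H.card_mul_index
    rw [hH, hcard, pow_succ] at h2
    exact finrank_cx_ne_two (h.trans (Nat.eq_of_mul_eq_mul_left (by positivity) h2))

/-- The normal closure over R of R[i](x) is a finite Galois extension of R, to which the finite case
applies. -/
theorem exists_algebraMap_cx_eq {A : Type*} [Field A] [Algebra (Cx R) A] [Algebra R A]
    [IsScalarTower R (Cx R) A] [Normal R A] (x : A) : ∃ c, algebraMap (Cx R) A c = x := by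
  have hint : IsIntegral (Cx R) x := (Normal.isIntegral (F := R) inferInstance x).tower_top
  obtain ⟨L, hL⟩ : ∃ L, L = IntermediateField.adjoin (Cx R) {x} := ⟨_, rfl⟩
  have : FiniteDimensional (Cx R) L := hL ▸ IntermediateField.adjoin.finiteDimensional hint
  have : FiniteDimensional R L := FiniteDimensional.trans R (Cx R) L
  have : IsScalarTower R L A := IsScalarTower.of_algebraMap_eq fun r => by
    rw [IsScalarTower.algebraMap_apply R (Cx R) A, IsScalarTower.algebraMap_apply R (Cx R) L]; rfl
  have : IsGalois R (IntermediateField.normalClosure R L A) := {}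
  -- Routing the `Cx R`-structure through `L` makes the upper tower hold by `rfl`.
  let _ : Algebra (Cx R) (IntermediateField.normalClosure R L A) :=
    ((algebraMap L (IntermediateField.normalClosure R L A)).comp (algebraMap (Cx R) L)).toAlgebra
  have : IsScalarTower (Cx R) L (IntermediateField.normalClosure R L A) :=
    IsScalarTower.of_algebraMap_eq fun _ => rfl
  have : IsScalarTower R (Cx R) (IntermediateField.normalClosure R L A) :=
    IsScalarTower.of_algebraMap_eq fun r => by
      rw [IsScalarTower.algebraMap_apply R L (IntermediateField.normalClosure R L A),
        IsScalarTower.algebraMap_apply R (Cx R) L]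
      rfl
  have h1 := finrank_cx_eq_one (R := R) (IntermediateField.normalClosure R L A)
  have h2 : FiniteDimensional (Cx R) (IntermediateField.normalClosure R L A) :=
    Module.finite_of_finrank_pos (by omega)
  have h3 : Module.finrank (Cx R) L = 1 := by
    have := Module.finrank_mul_finrank (Cx R) L (IntermediateField.normalClosure R L A)
    rw [h1] at this
    exact Nat.eq_one_of_mul_eq_one_right this
  have hbot : L = ⊥ := IntermediateField.finrank_eq_one_iff.1 h3
  exact IntermediateField.mem_bot.1
    (hbot ▸ hL ▸ IntermediateField.mem_adjoin_simple_self (Cx R) x)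

theorem isAlgClosed_cx : IsAlgClosed (Cx R) := by
  refine IsAlgClosed.of_exists_root _ fun p _ hp => ?_
  have hA : Algebra.IsAlgebraic R (AlgebraicClosure (Cx R)) := Algebra.IsAlgebraic.trans R (Cx R) _
  have : IsAlgClosure R (AlgebraicClosure (Cx R)) := ⟨inferInstance, hA⟩
  have : Normal R (AlgebraicClosure (Cx R)) := IsAlgClosure.normal R _
  obtain ⟨x, hx⟩ := IsAlgClosed.exists_aeval_eq_zero (AlgebraicClosure (Cx R)) p
    (degree_pos_of_irreducible hp).ne'
  obtain ⟨c, rfl⟩ := exists_algebraMap_cx_eq (R := R) x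
  refine ⟨c, ?_⟩
  rw [aeval_algebraMap_apply] at hx
  simpa using hx

end AlgClosed

/-! ### The intermediate value property for polynomials -/

section IntermediateValue

open Polynomial

/-- The remainder has degree at most 1 and vanishes at α + βi; since β ≠ 0, both its coefficients
are zero. -/
theorem quadratic_dvd {R : Type*} [Field R] [LinearOrder R] [IsStrictOrderedRing R] {P : R[X]}
    {α β : R} (hβ : β ≠ 0)
    (h : aeval (⟨α, β⟩ : Cx R) P = 0) : (X - C α) ^ 2 + C (β ^ 2) ∣ P := by
  have hm : ((X - C α) ^ 2 + C (β ^ 2)).Monic := by monicity!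
  have hd : ((X - C α) ^ 2 + C (β ^ 2)).natDegree = 2 := by compute_degree!
  have hmod := modByMonic_add_div P ((X - C α) ^ 2 + C (β ^ 2))
  have hq : aeval (⟨α, β⟩ : Cx R) ((X - C α) ^ 2 + C (β ^ 2)) = 0 := by
    simp only [map_add, map_pow, map_sub, aeval_X, aeval_C]
    ext <;> simp [pow_two]
  have hlt : (P %ₘ ((X - C α) ^ 2 + C (β ^ 2))).natDegree ≤ 1 := by
    have := natDegree_modByMonic_lt P hm (fun h1 => by rw [h1, natDegree_one] at hd; omega)
    omega
  rw [← modByMonic_eq_zero_iff_dvd hm]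
  obtain ⟨c, d, hcd⟩ := exists_eq_X_add_C_of_natDegree_le_one hlt
  rw [← hmod, map_add, map_mul, hq, zero_mul, add_zero, hcd] at h
  simp only [map_add, map_mul, aeval_X, aeval_C] at h
  have h1 := congrArg QuadraticAlgebra.im h
  have h2 := congrArg QuadraticAlgebra.re h
  simp at h1 h2
  have hc : c = 0 := by tauto
  subst hc
  have hd : d = 0 := by simpa using h2
  rw [hcd, hd]; simp

variable {R : Type*} [Field R] [LinearOrder R] [IsStrictOrderedRing R] [IsRealClosed R]

/-- Induction on the degree: a root in R[i] splits off a linear factor with root outside [a, b] or a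
positive quadratic factor, and either has constant sign on [a, b]. -/
theorem sign_eval_eq_of_no_root (P : R[X]) {a b : R} (hab : a ≤ b)
    (h : ∀ x ∈ Set.Icc a b, P.eval x ≠ 0) :
    SignType.sign (P.eval a) = SignType.sign (P.eval b) := by
  induction hn : P.natDegree using Nat.strong_induction_on generalizing P with
  | _ n ih =>
    subst hn
    by_cases h0 : P.natDegree = 0
    · rw [eq_C_of_natDegree_eq_zero h0]; simp
    have := isAlgClosed_cx (R := R)
    have hP0 : P ≠ 0 := by rintro rfl; simp at h0
    obtain ⟨⟨α, β⟩, hz⟩ := IsAlgClosed.exists_aeval_eq_zero (Cx R) P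
      (fun hd => h0 (natDegree_eq_of_degree_eq_some hd))
    have key : ∀ S Q : R[X], P = S * Q → S.natDegree ≠ 0 →
        SignType.sign (S.eval a) = SignType.sign (S.eval b) →
        SignType.sign (P.eval a) = SignType.sign (P.eval b) := by
      rintro S Q rfl hS hs
      have hQ := ih Q.natDegree (by
        rw [natDegree_mul (left_ne_zero_of_mul hP0) (right_ne_zero_of_mul hP0)]; omega) Q
        (fun x hx hq => h x hx (by simp [hq])) rfl
      simp [sign_mul, hs, hQ]
    by_cases hβ : β = 0
    · subst hβ
      have hr : P.eval α = 0 := by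
        have : aeval (algebraMap R (Cx R) α) P = 0 := hz
        rw [aeval_algebraMap_apply] at this
        simpa using this
      obtain ⟨Q, hQ⟩ := dvd_iff_isRoot.2 hr
      refine key _ Q hQ (by simp) ?_
      have hα : α < a ∨ b < α := by
        by_contra! hc
        exact h α ⟨hc.1, hc.2⟩ hr
      rcases hα with hα | hα
      · simp only [eval_sub, eval_X, eval_C]
        rw [sign_pos (by linarith), sign_pos (by linarith)]
      · simp only [eval_sub, eval_X, eval_C]
        rw [sign_neg (by linarith), sign_neg (by linarith)]
    · obtain ⟨Q, hQ⟩ := quadratic_dvd hβ hz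
      have hd : ((X - C α) ^ 2 + C (β ^ 2)).natDegree = 2 := by compute_degree!
      refine key _ Q hQ (by omega) ?_
      simp only [eval_add, eval_pow, eval_sub, eval_X, eval_C]
      rw [sign_pos (by positivity), sign_pos (by positivity)]

end IntermediateValue

end RectWinding

namespace RectWinding

/-! ### One-sided signs of polynomials -/

section Germ

open Polynomial

variable {R : Type*} [Field R] [LinearOrder R]

/-- The sign of `r`, as a rational number. -/
def sgn (r : R) : ℚ := ((SignType.sign r : SignType) : ℚ)

/-- The leading coefficient of `P` at `x`, that is, the value of `cofactorAt P x` at `x`. -/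
noncomputable def leadAt (P : R[X]) (x : R) : R := (cofactorAt P x).eval x

/-- The sign of `P` immediately to the right of `x` (for `e = 1`) or to the left of `x`
(for `e = -1`). -/
noncomputable def germSign (e : ℚ) (P : R[X]) (x : R) : ℚ :=
  e ^ P.rootMultiplicity x * sgn (leadAt P x)

theorem sgn_zero : sgn (0 : R) = 0 := by simp [sgn]

theorem germSign_zero (e : ℚ) (x : R) : germSign e (0 : R[X]) x = 0 := by
  simp [germSign, leadAt, cofactorAt, sgn_zero]

theorem leadAt_ne_zero {P : R[X]} (hP : P ≠ 0) (x : R) : leadAt P x ≠ 0 :=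
  eval_divByMonic_pow_rootMultiplicity_ne_zero x hP

theorem X_sub_C_pow_mul_cofactorAt (P : R[X]) (x : R) :
    (X - C x) ^ P.rootMultiplicity x * cofactorAt P x = P :=
  pow_mul_divByMonic_rootMultiplicity_eq P x

theorem rootMultiplicity_of_eval_ne_zero {p : R[X]} {x : R} (hp : p.eval x ≠ 0) (k : ℕ) :
    ((X - C x) ^ k * p).rootMultiplicity x = k := by
  have hp0 : p ≠ 0 := by rintro rfl; simp at hp
  rw [rootMultiplicity_mul (mul_ne_zero (pow_ne_zero _ (X_sub_C_ne_zero x)) hp0),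
    rootMultiplicity_X_sub_C_pow, rootMultiplicity_eq_zero hp, add_zero]

theorem leadAt_of_eval_ne_zero {p : R[X]} {x : R} (hp : p.eval x ≠ 0) (k : ℕ) :
    leadAt ((X - C x) ^ k * p) x = p.eval x := by
  rw [leadAt, cofactorAt, rootMultiplicity_of_eval_ne_zero hp,
    mul_divByMonic_cancel_left _ ((monic_X_sub_C x).pow k)]

theorem leadAt_mul (P Q : R[X]) (x : R) : leadAt (P * Q) x = leadAt P x * leadAt Q x := by
  by_cases hP : P = 0
  · simp [hP, leadAt, cofactorAt]
  by_cases hQ : Q = 0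
  · simp [hQ, leadAt, cofactorAt]
  have h : P * Q = (X - C x) ^ (P.rootMultiplicity x + Q.rootMultiplicity x) *
      (cofactorAt P x * cofactorAt Q x) := by
    conv_lhs => rw [← X_sub_C_pow_mul_cofactorAt P x, ← X_sub_C_pow_mul_cofactorAt Q x]
    ring
  rw [h, leadAt_of_eval_ne_zero]
  · simp [leadAt]
  · simpa using ⟨leadAt_ne_zero hP x, leadAt_ne_zero hQ x⟩

variable [IsStrictOrderedRing R]

theorem sgn_mul (r s : R) : sgn (r * s) = sgn r * sgn s := by simp [sgn, sign_mul]

theorem sgn_of_pos {r : R} (h : 0 < r) : sgn r = 1 := by simp [sgn, h]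

theorem sgn_of_neg {r : R} (h : r < 0) : sgn r = -1 := by simp [sgn, h]

theorem sgn_neg (r : R) : sgn (-r) = -sgn r := by
  rw [← neg_one_mul, sgn_mul, sgn_of_neg (by norm_num)]; ring

theorem sgn_mul_self {r : R} (h : r ≠ 0) : sgn r * sgn r = 1 := by
  rw [← sgn_mul, sgn_of_pos (mul_self_pos.2 h)]

theorem sgn_add {r s : R} (h : sgn r = sgn s) : sgn (r + s) = sgn r := by
  rcases lt_trichotomy r 0 with hr | rfl | hr <;> rcases lt_trichotomy s 0 with hs | rfl | hs <;>
    first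
    | rw [sgn_of_neg hr, sgn_of_neg (add_neg hr hs)]
    | rw [sgn_of_pos hr, sgn_of_pos (add_pos hr hs)]
    | rw [add_zero]
    | (exfalso
       simp only [sgn_of_pos, sgn_of_neg, sgn_zero, *] at h
       norm_num at h)

theorem germSign_of_eval_ne_zero {p : R[X]} {x : R} (hp : p.eval x ≠ 0) (e : ℚ) :
    germSign e p x = sgn (p.eval x) := by
  have := leadAt_of_eval_ne_zero hp 0
  rw [pow_zero, one_mul] at this
  rw [germSign, rootMultiplicity_eq_zero hp, this]; simp

theorem germSign_mul (e : ℚ) (P Q : R[X]) (x : R) :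
    germSign e (P * Q) x = germSign e P x * germSign e Q x := by
  by_cases hP : P = 0
  · simp [hP, germSign_zero]
  by_cases hQ : Q = 0
  · simp [hQ, germSign_zero]
  simp only [germSign, rootMultiplicity_mul (mul_ne_zero hP hQ), leadAt_mul, sgn_mul]
  ring

theorem germSign_X_sub_C (e : ℚ) (x : R) : germSign e (X - C x) x = e := by
  have := leadAt_of_eval_ne_zero (p := (1 : R[X])) (x := x) (by simp) 1
  simp at this
  rw [germSign, rootMultiplicity_X_sub_C_self, this, sgn_of_pos one_pos]; simp

theorem germSign_sq {e : ℚ} (he : e * e = 1) {P : R[X]} (hP : P ≠ 0) (x : R) :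
    germSign e P x * germSign e P x = 1 := by
  have h := sgn_mul_self (leadAt_ne_zero hP x)
  have h2 : e ^ P.rootMultiplicity x * e ^ P.rootMultiplicity x = 1 := by
    rw [← mul_pow, he, one_pow]
  rw [germSign]
  linear_combination h + sgn (leadAt P x) * sgn (leadAt P x) * h2

/-- The term of lower order dominates; at equal orders, leading coefficients of the same sign cannot
cancel. -/
theorem germSign_add {e : ℚ} (he : e * e = 1) {P Q : R[X]} {x : R}
    (h : germSign e P x = germSign e Q x) : germSign e (P + Q) x = germSign e P x := by
  have he0 : e ≠ 0 := by rintro rfl; simp at he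
  wlog hle : P.rootMultiplicity x ≤ Q.rootMultiplicity x generalizing P Q
  · rw [add_comm, this h.symm (by omega), h]
  by_cases hP : P = 0
  · subst hP
    rw [zero_add, h]
  by_cases hQ : Q = 0
  · simp [hQ]
  obtain ⟨d, hd⟩ := Nat.exists_eq_add_of_le hle
  have hsum : P + Q = (X - C x) ^ P.rootMultiplicity x *
      (cofactorAt P x + (X - C x) ^ d * cofactorAt Q x) := by
    conv_lhs => rw [← X_sub_C_pow_mul_cofactorAt P x, ← X_sub_C_pow_mul_cofactorAt Q x, hd]
    ring
  have hs : sgn ((cofactorAt P x + (X - C x) ^ d * cofactorAt Q x).eval x) =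
      sgn (leadAt P x) := by
    rcases d with _ | d
    · simp only [germSign, hd, add_zero] at h
      simp only [pow_zero, one_mul, eval_add]
      exact sgn_add (mul_left_cancel₀ (pow_ne_zero _ he0) h)
    · simp [leadAt]
  have hne : (cofactorAt P x + (X - C x) ^ d * cofactorAt Q x).eval x ≠ 0 := by
    intro h0
    have h1 := sgn_mul_self (leadAt_ne_zero hP x)
    rw [← hs, h0, sgn_zero] at h1
    norm_num at h1
  rw [hsum, germSign, rootMultiplicity_of_eval_ne_zero hne, leadAt_of_eval_ne_zero hne, hs,
    germSign]

/-- The relation between the signs of two germs and the sign of their sum. -/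
theorem germSign_add_identity {e : ℚ} (he : e * e = 1) (P Q : R[X]) (x : R) :
    germSign e (P + Q) x - germSign e P x - germSign e Q x +
      germSign e P x * germSign e Q x * germSign e (P + Q) x = 0 := by
  by_cases hP : P = 0
  · simp [hP, germSign_zero]
  by_cases hQ : Q = 0
  · simp [hQ, germSign_zero]
  have h1 := germSign_sq he hP x
  have h2 := germSign_sq he hQ x
  -- Both signs are ±1. If they are equal, the sum has the same sign; if opposite, their product is
  -- -1 and the sign of the sum drops out.
  have h3 : germSign e P x = germSign e Q x ∨ germSign e P x = -germSign e Q x :=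
    mul_self_eq_mul_self_iff.1 (h1.trans h2.symm)
  rcases h3 with h | h
  · rw [germSign_add he h, h]; linear_combination germSign e Q x * h2
  · rw [h]; linear_combination -germSign e (P + Q) x * h2

end Germ

/-! ### Sums of one-sided jumps and telescoping -/

section SideSum

open Polynomial

variable {R : Type*} [Field R] [LinearOrder R]

/-- The sum of the jumps `f x - g x` over `[a, b]`, where `f x` is attached to
the right side and `g x` to the left side of the point `x`. -/
noncomputable def sideSum (f g : R → ℚ) (a b : R) : ℚ :=
  f a + ∑ᶠ x ∈ Set.Ioo a b, (f x - g x) - g b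

theorem sideSum_add {f g f' g' : R → ℚ} {a b : R} (h : (Function.support (f - g)).Finite)
    (h' : (Function.support (f' - g')).Finite) :
    sideSum (f + f') (g + g') a b = sideSum f g a b + sideSum f' g' a b := by
  have : ∑ᶠ x ∈ Set.Ioo a b, ((f + f') x - (g + g') x) =
      ∑ᶠ x ∈ Set.Ioo a b, (f x - g x) + ∑ᶠ x ∈ Set.Ioo a b, (f' x - g' x) := by
    have hf : (Function.support fun x => f x - g x).Finite := h
    have hf' : (Function.support fun x => f' x - g' x).Finite := h'
    rw [← finsum_mem_add_distrib' (hf.subset Set.inter_subset_right)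
      (hf'.subset Set.inter_subset_right)]
    exact finsum_mem_congr rfl fun x _ => by simp only [Pi.add_apply]; ring
  rw [sideSum, sideSum, sideSum, this, Pi.add_apply, Pi.add_apply]
  ring

theorem sideSum_smul (c : ℚ) (f g : R → ℚ) (a b : R) :
    sideSum (c • f) (c • g) a b = c * sideSum f g a b := by
  have : ∑ᶠ x ∈ Set.Ioo a b, ((c • f) x - (c • g) x) = c * ∑ᶠ x ∈ Set.Ioo a b, (f x - g x) := by
    rw [finsum_mem_def, finsum_mem_def, ← smul_eq_mul, smul_finsum]
    refine finsum_congr fun x => ?_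
    by_cases hx : x ∈ Set.Ioo a b <;> simp only [Set.indicator_of_mem, Set.indicator_of_notMem, hx,
      Pi.smul_apply, smul_eq_mul, not_false_eq_true, mul_zero]
    ring
  rw [sideSum, sideSum, this, Pi.smul_apply, Pi.smul_apply, smul_eq_mul, smul_eq_mul]
  ring

theorem sideSum_self (f : R → ℚ) (a b : R) : sideSum f f a b = f a - f b := by
  simp [sideSum]

theorem sideSum_split {f g : R → ℚ} (h : (Function.support (f - g)).Finite) {a b c : R}
    (hac : a < c) (hcb : c < b) : sideSum f g a b = sideSum f g a c + sideSum f g c b := by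
  have h1 : Set.Ioo a b = insert c (Set.Ioo a c ∪ Set.Ioo c b) := by
    ext x
    simp only [Set.mem_Ioo, Set.mem_insert_iff, Set.mem_union]
    constructor
    · rintro ⟨h1, h2⟩
      rcases lt_trichotomy x c with h | h | h <;> simp [*]
    · rintro (rfl | h | h)
      · exact ⟨hac, hcb⟩
      · exact ⟨h.1, h.2.trans hcb⟩
      · exact ⟨hac.trans h.1, h.2⟩
  have h2 : Disjoint (Set.Ioo a c) (Set.Ioo c b) :=
    Set.disjoint_left.2 fun x hx hy => lt_asymm hx.2 hy.1
  have hf : (Function.support fun x => f x - g x).Finite := h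
  rw [sideSum, h1, finsum_mem_insert' _ (by simp) (hf.subset Set.inter_subset_right),
    finsum_mem_union' h2 (hf.subset Set.inter_subset_right) (hf.subset Set.inter_subset_right),
    sideSum, sideSum]
  ring

variable [IsStrictOrderedRing R]

theorem finite_support_germSign (P : R[X]) :
    (Function.support (germSign 1 P - germSign (-1) P)).Finite := by
  classical
  by_cases hP : P = 0
  · simp [hP, germSign_zero, Function.support_eq_empty_iff.2, funext_iff]
  refine P.roots.toFinset.finite_toSet.subset fun x hx => ?_
  by_contra hne
  apply hx
  have h : P.eval x ≠ 0 := by simpa [hP] using hne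
  simp [germSign_of_eval_ne_zero h]

variable [IsRealClosed R]

/-- Zeros at the endpoints are factored out. Powers of T - a are positive on (a, b), each factor T -
b contributes -1 at both ends, and the remaining cofactor has no zero on [a, b]. -/
theorem germSign_eq_of_no_root {P : R[X]} {a b : R} (hab : a < b)
    (h : ∀ x ∈ Set.Ioo a b, P.eval x ≠ 0) : germSign 1 P a = germSign (-1) P b := by
  by_cases hP : P = 0
  · simp [hP, germSign_zero]
  have h1 := X_sub_C_pow_mul_cofactorAt P a
  set N := cofactorAt P a with hN
  have hNa : N.eval a ≠ 0 := leadAt_ne_zero hP a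
  have hN0 : N ≠ 0 := by rintro h0; simp [h0] at hNa
  have h2 := X_sub_C_pow_mul_cofactorAt N b
  set M := cofactorAt N b
  have hMb : M.eval b ≠ 0 := leadAt_ne_zero hN0 b
  have hMa : M.eval a ≠ 0 := by
    intro h0; rw [← h2] at hNa; simp [h0] at hNa
  have hP' : P = (X - C a) ^ P.rootMultiplicity a * ((X - C b) ^ N.rootMultiplicity b * M) := by
    rw [h2, h1]
  generalize P.rootMultiplicity a = k at hP'
  generalize N.rootMultiplicity b = l at hP'
  have hs : sgn (M.eval a) = sgn (M.eval b) := by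
    unfold sgn
    rw [sign_eval_eq_of_no_root M hab.le]
    intro x hx h0
    rcases hx.1.eq_or_lt with rfl | hx1
    · exact hMa h0
    rcases hx.2.eq_or_lt with rfl | hx2
    · exact hMb h0
    exact h x ⟨hx1, hx2⟩ (by rw [hP']; simp [h0])
  have hpow : ∀ (e : ℚ) (c x : R) (n : ℕ), germSign e ((X - C c) ^ n) x =
      germSign e (X - C c) x ^ n := by
    intro e c x n
    induction n with
    | zero =>
      rw [pow_zero, pow_zero, germSign_of_eval_ne_zero (by simp)]
      simpa using sgn_of_pos one_pos
    | succ n ih => rw [pow_succ, germSign_mul, ih, pow_succ]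
  have e1 : germSign 1 (X - C b) a = -1 := by
    rw [germSign_of_eval_ne_zero (by simpa [sub_eq_zero] using hab.ne)]
    exact sgn_of_neg (by simpa using hab)
  have e2 : germSign (-1) (X - C a) b = 1 := by
    rw [germSign_of_eval_ne_zero (by simpa [sub_eq_zero] using hab.ne')]
    exact sgn_of_pos (by simpa using hab)
  rw [hP']
  simp only [germSign_mul, hpow, germSign_X_sub_C, e1, e2, germSign_of_eval_ne_zero hMa,
    germSign_of_eval_ne_zero hMb, hs]

/-- The sign changes of a polynomial telescope: this is the only use of the intermediate value
property. -/
theorem sideSum_germSign (P : R[X]) {a b : R} (hab : a < b) :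
    sideSum (germSign 1 P) (germSign (-1) P) a b = 0 := by
  classical
  by_cases hP : P = 0
  · subst hP; simp [sideSum, germSign_zero]
  induction hn : (P.roots.toFinset.filter (fun x => x ∈ Set.Ioo a b)).card using
    Nat.strong_induction_on generalizing a b with
  | _ n ih =>
    subst hn
    by_cases h : ∀ x ∈ Set.Ioo a b, P.eval x ≠ 0
    · have h0 : ∑ᶠ x ∈ Set.Ioo a b, (germSign 1 P x - germSign (-1) P x) = 0 := by
        refine finsum_mem_eq_zero_of_forall_eq_zero fun x hx => ?_
        rw [germSign_of_eval_ne_zero (h x hx), germSign_of_eval_ne_zero (h x hx), sub_self]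
      rw [sideSum, h0, germSign_eq_of_no_root hab h]
      simp
    -- Cutting at a root removes it from both open subintervals.
    · push Not at h
      obtain ⟨c, hc, hPc⟩ := h
      have hmem : c ∈ P.roots.toFinset.filter (fun x => x ∈ Set.Ioo a b) := by
        simp [hP, hPc, hc.1, hc.2]
      rw [sideSum_split (finite_support_germSign P) hc.1 hc.2, ih _ _ hc.1 rfl, ih _ _ hc.2 rfl,
        add_zero]
      all_goals
        refine Finset.card_lt_card (Finset.ssubset_iff_of_subset ?_ |>.2 ⟨c, hmem, by simp⟩)
        intro x hx
        simp only [Finset.mem_filter, Set.mem_Ioo] at hx ⊢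
      · exact ⟨hx.1, hc.1.trans hx.2.1, hx.2.2⟩
      · exact ⟨hx.1, hx.2.1, hx.2.2.trans hc.2⟩

end SideSum

end RectWinding

namespace RectWinding

/-! ### Local formulas for the Cauchy index -/

section LocalIndex

open Polynomial

variable {R : Type*} [Field R] [LinearOrder R]

open Classical in
/-- The common form of `Ind_x^+` (for `e = 1`) and of `Ind_x^-` (for `e = -1`). -/
noncomputable def indSide (e : ℚ) (P Q : R[X]) (x : R) : ℚ :=
  if P ≠ 0 ∧ Q ≠ 0 ∧ valAt P Q x < 0 then (1 / 2) * e ^ valAt P Q x * leadSign P Q x else 0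

theorem indSide_one (P Q : R[X]) : indSide 1 P Q = indRight P Q := by
  ext x; simp [indSide, indRight]

theorem indSide_neg_one (P Q : R[X]) : indSide (-1) P Q = indLeft P Q := by
  ext x; simp [indSide, indLeft]

theorem indLT_eq_sideSum (P Q : R[X]) (a b : R) :
    indLT P Q a b = sideSum (indSide 1 P Q) (indSide (-1) P Q) a b := by
  rw [indSide_one, indSide_neg_one]; rfl

theorem finite_support_indSide (P Q : R[X]) :
    (Function.support (indSide 1 P Q - indSide (-1) P Q)).Finite := by
  rw [indSide_one, indSide_neg_one]; exact finite_support_indAt P Q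

theorem indSide_zero_left (e : ℚ) (Q : R[X]) (x : R) : indSide e 0 Q x = 0 := by simp [indSide]

theorem indSide_zero_right (e : ℚ) (P : R[X]) (x : R) : indSide e P 0 x = 0 := by simp [indSide]

variable [IsStrictOrderedRing R]

theorem leadSign_eq (P Q : R[X]) (x : R) : leadSign P Q x = sgn (leadAt P x) * sgn (leadAt Q x) :=
  sgn_mul _ _

/-- The multiplicity of S cancels in the valuation, and the sign of its leading coefficient enters
squared. Pairs can therefore be reduced to ones without a common zero. -/
theorem indSide_mul_left (e : ℚ) {S : R[X]} (hS : S ≠ 0) (P Q : R[X]) (x : R) :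
    indSide e (S * P) (S * Q) x = indSide e P Q x := by
  by_cases hP : P = 0
  · simp [hP, indSide_zero_left]
  by_cases hQ : Q = 0
  · simp [hQ, indSide_zero_right]
  have h1 : valAt (S * P) (S * Q) x = valAt P Q x := by
    simp only [valAt, rootMultiplicity_mul (mul_ne_zero hS hP),
      rootMultiplicity_mul (mul_ne_zero hS hQ)]
    push_cast
    ring
  have h2 : leadSign (S * P) (S * Q) x = leadSign P Q x := by
    simp only [leadSign_eq, leadAt_mul, sgn_mul]
    linear_combination sgn (leadAt P x) * sgn (leadAt Q x) * sgn_mul_self (leadAt_ne_zero hS x)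
  simp [indSide, h1, h2, hS, hP, hQ]

/-- For a reduced pair the poles are the zeros of q. The exponent -m may be replaced by m because e
= ±1. -/
theorem indSide_eq_ite {e : ℚ} (he : e * e = 1) {p q : R[X]} {x : R}
    (h : p.eval x ≠ 0 ∨ q.eval x ≠ 0) :
    indSide e p q x = if q.eval x = 0 then 1 / 2 * sgn (p.eval x) * germSign e q x else 0 := by
  by_cases hq0 : q = 0
  · simp [hq0, indSide_zero_right, germSign_zero]
  split_ifs with hq
  · have hp : p.eval x ≠ 0 := h.resolve_right (not_not.2 hq)
    have hp0 : p ≠ 0 := by rintro rfl; simp at hp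
    have hv : valAt p q x = -(q.rootMultiplicity x : ℤ) := by
      simp [valAt, rootMultiplicity_eq_zero hp]
    have hm : 0 < q.rootMultiplicity x := (rootMultiplicity_pos hq0).2 hq
    have hl : leadAt p x = p.eval x := by simpa using leadAt_of_eval_ne_zero hp 0
    have hinv : e⁻¹ = e := inv_eq_of_mul_eq_one_left he
    rw [indSide, if_pos ⟨hp0, hq0, by omega⟩, hv, zpow_neg, zpow_natCast, ← inv_pow, hinv,
      leadSign_eq, hl, germSign]
    ring
  · have hm : q.rootMultiplicity x = 0 := rootMultiplicity_eq_zero hq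
    rw [indSide, if_neg]
    rintro ⟨-, -, h3⟩
    rw [valAt, hm] at h3
    omega

/-- The local product formula for the Cauchy index. -/
theorem indSide_mul {e : ℚ} (he : e * e = 1) {p q r s : R[X]} {x : R}
    (h : p.eval x ≠ 0 ∨ q.eval x ≠ 0) (h' : r.eval x ≠ 0 ∨ s.eval x ≠ 0) :
    indSide e (p * r - q * s) (p * s + q * r) x - indSide e p q x - indSide e r s x +
      1 / 2 * germSign e (q * s * (p * s + q * r)) x =
    1 / 2 * sgn (q.eval x * s.eval x * (p.eval x * s.eval x + q.eval x * r.eval x)) := by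
  -- The norm p² + q² is multiplicative, so the product pair is again reduced.
  have hred : (p * r - q * s).eval x ≠ 0 ∨ (p * s + q * r).eval x ≠ 0 := by
    by_contra! hc
    simp only [eval_sub, eval_add, eval_mul] at hc
    have h1 : (p.eval x ^ 2 + q.eval x ^ 2) * (r.eval x ^ 2 + s.eval x ^ 2) = 0 := by
      linear_combination (p.eval x * r.eval x - q.eval x * s.eval x) * hc.1 +
        (p.eval x * s.eval x + q.eval x * r.eval x) * hc.2
    rcases mul_eq_zero.1 h1 with h1 | h1
    · have : 0 < p.eval x ^ 2 + q.eval x ^ 2 := by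
        rcases h with h | h <;> positivity
      exact this.ne' h1
    · have : 0 < r.eval x ^ 2 + s.eval x ^ 2 := by
        rcases h' with h | h <;> positivity
      exact this.ne' h1
  rw [indSide_eq_ite he h, indSide_eq_ite he h', indSide_eq_ite he hred]
  simp only [germSign_mul, eval_sub, eval_add, eval_mul, sgn_mul] at hred ⊢
  -- When q and s both vanish, the claim is the sign identity for the germs of ps and qr. Otherwise
  -- at most one of q, s and ps + qr vanishes.
  by_cases hq : q.eval x = 0 <;> by_cases hs : s.eval x = 0
  · have hp := h.resolve_right (not_not.2 hq)
    have hr := h'.resolve_right (not_not.2 hs)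
    have h1 := germSign_add_identity he (p * s) (q * r) x
    simp only [germSign_mul, germSign_of_eval_ne_zero hp, germSign_of_eval_ne_zero hr] at h1
    simp only [hq, hs, mul_zero, zero_mul, add_zero, sub_zero, if_true, sgn_zero, sgn_mul]
    have h2 := sgn_mul_self hp
    have h3 := sgn_mul_self hr
    linear_combination (1 / 2) * sgn (p.eval x) * sgn (r.eval x) * h1 +
      1 / 2 * (germSign e s x * sgn (r.eval x) - germSign e q x * germSign e s x *
        germSign e (p * s + q * r) x * sgn (r.eval x) ^ 2) * h2 +
      1 / 2 * (germSign e q x * sgn (p.eval x) - germSign e q x * germSign e s x *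
        germSign e (p * s + q * r) x) * h3
  · have hp := h.resolve_right (not_not.2 hq)
    have hm : (p * s + q * r).eval x ≠ 0 := by simp [hq, hp, hs]
    have hm' : (p * s + q * r).eval x = p.eval x * s.eval x := by simp [hq]
    rw [germSign_of_eval_ne_zero hm, hm', germSign_of_eval_ne_zero hs]
    simp only [hq, hs, hp, mul_zero, zero_mul, add_zero, sub_zero, if_true, if_false, sgn_zero,
      sgn_mul, mul_eq_zero, or_self]
    linear_combination 1 / 2 * germSign e q x * sgn (p.eval x) * sgn_mul_self hs
  · have hr := h'.resolve_right (not_not.2 hs)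
    have hm : (p * s + q * r).eval x ≠ 0 := by simp [hq, hr, hs]
    have hm' : (p * s + q * r).eval x = q.eval x * r.eval x := by simp [hs]
    rw [germSign_of_eval_ne_zero hm, hm', germSign_of_eval_ne_zero hq]
    simp only [hq, hs, hr, mul_zero, zero_mul, zero_add, sub_zero, if_true, if_false, sgn_zero,
      sgn_mul, mul_eq_zero, or_self]
    linear_combination 1 / 2 * germSign e s x * sgn (r.eval x) * sgn_mul_self hq
  · rw [germSign_of_eval_ne_zero hq, germSign_of_eval_ne_zero hs]
    by_cases hm : p.eval x * s.eval x + q.eval x * r.eval x = 0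
    -- At a zero of ps + qr the real part of the product has sign opposite to that of qs, so its
    -- index term cancels the germ sign.
    · have h1 : (p.eval x * r.eval x - q.eval x * s.eval x) * (q.eval x * s.eval x) < 0 := by
        have : (p.eval x * r.eval x - q.eval x * s.eval x) * (q.eval x * s.eval x) =
            -((q.eval x) ^ 2 * (r.eval x ^ 2 + s.eval x ^ 2)) := by
          linear_combination q.eval x * r.eval x * hm
        rw [this]
        have : 0 < (q.eval x) ^ 2 * (r.eval x ^ 2 + s.eval x ^ 2) := by positivity
        linarith
      have h2 := sgn_of_neg h1
      rw [sgn_mul, sgn_mul] at h2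
      simp only [hq, hs, hm, if_true, if_false, sgn_zero]
      have h3 := sgn_mul_self hq
      have h4 := sgn_mul_self hs
      linear_combination (1 / 2) * germSign e (p * s + q * r) x * sgn (q.eval x) *
        sgn (s.eval x) * h2 - 1 / 2 * germSign e (p * s + q * r) x *
          sgn (p.eval x * r.eval x - q.eval x * s.eval x) * (h3 + sgn (q.eval x) ^ 2 * h4)
    · have hm' : (p * s + q * r).eval x ≠ 0 := by simpa using hm
      rw [germSign_of_eval_ne_zero hm']
      simp [hq, hs, hm]

/-- The Cauchy indices of `P / Q` and `-Q / P` add up to that of `(P ^ 2 - Q ^ 2) / (2 P Q)`. -/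
theorem indSide_add_inv_of_reduced {e : ℚ} (he : e * e = 1) {p q : R[X]} {x : R}
    (h : p.eval x ≠ 0 ∨ q.eval x ≠ 0) :
    indSide e p q x + indSide e (-q) p x = indSide e (p * p - q * q) (p * q + q * p) x := by
  have h1 : (-q).eval x ≠ 0 ∨ p.eval x ≠ 0 := by simpa using h.symm
  have h2 : (p * p - q * q).eval x ≠ 0 ∨ (p * q + q * p).eval x ≠ 0 := by
    by_contra! hc
    simp only [eval_sub, eval_add, eval_mul] at hc
    have h3 : (p.eval x ^ 2 + q.eval x ^ 2) ^ 2 = 0 := by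
      linear_combination (p.eval x * p.eval x - q.eval x * q.eval x) * hc.1 +
        (p.eval x * q.eval x + q.eval x * p.eval x) * hc.2
    have : 0 < (p.eval x ^ 2 + q.eval x ^ 2) ^ 2 := by
      rcases h with h | h <;> positivity
    exact this.ne' h3
  -- Doubling pq does not change its germ sign.
  have h4 : germSign e (p * q + q * p) x = germSign e p x * germSign e q x := by
    rw [mul_comm q p, germSign_add he rfl, germSign_mul]
  rw [indSide_eq_ite he h, indSide_eq_ite he h1, indSide_eq_ite he h2, h4]
  have h5 : (p * q + q * p).eval x = 0 ↔ p.eval x = 0 ∨ q.eval x = 0 := by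
    simp [mul_comm (q.eval x), ← two_mul]
  simp only [h5]
  by_cases hp : p.eval x = 0
  · have hq := h.resolve_left (not_not.2 hp)
    simp only [hp, hq, if_true, if_false, true_or, eval_neg, eval_sub, eval_mul, mul_zero, zero_sub,
      sgn_neg, sgn_mul, germSign_of_eval_ne_zero hq, sgn_mul_self hq]
    ring
  · by_cases hq : q.eval x = 0
    · simp only [hp, hq, if_true, if_false, or_true, eval_sub, eval_mul, mul_zero, sub_zero,
        sgn_mul, germSign_of_eval_ne_zero hp, sgn_mul_self hp]
      ring
    · simp [hp, hq]

end LocalIndex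

/-! ### Removing common real factors -/

section Reduction

open Polynomial

variable {R : Type*} [Field R]

theorem quadraticAlgebra_re_mul {S : Type*} [CommRing S] (z w : QuadraticAlgebra S (-1) 0) :
    (z * w).re = z.re * w.re - z.im * w.im := by
  simp; ring

theorem quadraticAlgebra_im_mul {S : Type*} [CommRing S] (z w : QuadraticAlgebra S (-1) 0) :
    (z * w).im = z.re * w.im + z.im * w.re := by
  simp

/-- The complex polynomial `z` has, after removal of some nonzero real factor, the nonzero value `v`
at the point `x`. -/
def ReducesTo (z : QuadraticAlgebra R[X] (-1) 0) (x : R) (v : Cx R) : Prop :=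
  ∃ g p q : R[X], g ≠ 0 ∧ z = ⟨g * p, g * q⟩ ∧ v = ⟨p.eval x, q.eval x⟩ ∧
    (p.eval x ≠ 0 ∨ q.eval x ≠ 0)

theorem ReducesTo.ne_zero {z : QuadraticAlgebra R[X] (-1) 0} {x : R} {v : Cx R}
    (h : ReducesTo z x v) : z ≠ 0 := by
  obtain ⟨g, p, q, hg, rfl, -, hpq⟩ := h
  intro h0
  have h1 : g * p = 0 := congrArg QuadraticAlgebra.re h0
  have h2 : g * q = 0 := congrArg QuadraticAlgebra.im h0
  have h1' : p = 0 := (mul_eq_zero.1 h1).resolve_left hg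
  have h2' : q = 0 := (mul_eq_zero.1 h2).resolve_left hg
  simp [h1', h2'] at hpq

/-- After division by the gcd, a Bézout relation excludes a common zero. -/
theorem exists_reducesTo {z : QuadraticAlgebra R[X] (-1) 0} (hz : z ≠ 0) (x : R) :
    ∃ v, ReducesTo z x v := by
  obtain ⟨P, Q⟩ := z
  by_cases hQ : Q = 0
  · subst hQ
    refine ⟨_, P, 1, 0, ?_, by simp, rfl, by simp⟩
    rintro rfl
    exact hz rfl
  · classical
    have hg : gcd P Q ≠ 0 := gcd_ne_zero_of_right hQ
    refine ⟨_, gcd P Q, P / gcd P Q, Q / gcd P Q, hg, ?_, rfl, ?_⟩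
    · rw [EuclideanDomain.mul_div_cancel' hg (gcd_dvd_left P Q),
        EuclideanDomain.mul_div_cancel' hg (gcd_dvd_right P Q)]
    · obtain ⟨a, b, hab⟩ := isCoprime_div_gcd_div_gcd (p := P) hQ
      by_contra! hc
      have := congrArg (eval x) hab
      simp [hc.1, hc.2] at this

end Reduction

/-! ### The product formula on an interval -/

section Edge

open Polynomial

variable {R : Type*} [Field R] [LinearOrder R] [IsStrictOrderedRing R]

theorem ReducesTo.mul {z w : QuadraticAlgebra R[X] (-1) 0} {x : R} {v u : Cx R}
    (h : ReducesTo z x v) (h' : ReducesTo w x u) : ReducesTo (z * w) x (v * u) := by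
  obtain ⟨g, p, q, hg, rfl, rfl, hpq⟩ := h
  obtain ⟨k, r, s, hk, rfl, rfl, hrs⟩ := h'
  refine ⟨g * k, p * r - q * s, p * s + q * r, mul_ne_zero hg hk, ?_, ?_, ?_⟩
  · ext1 <;> simp only [quadraticAlgebra_re_mul, quadraticAlgebra_im_mul] <;> ring
  · ext1 <;> simp only [quadraticAlgebra_re_mul, quadraticAlgebra_im_mul, eval_sub, eval_mul,
      eval_add]
  · have hv : (⟨p.eval x, q.eval x⟩ : Cx R) ≠ 0 := fun h => by
      simp [QuadraticAlgebra.ext_iff] at h; tauto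
    have hu : (⟨r.eval x, s.eval x⟩ : Cx R) ≠ 0 := fun h => by
      simp [QuadraticAlgebra.ext_iff] at h; tauto
    by_contra! hc
    refine mul_ne_zero hv hu ?_
    ext1
    · rw [quadraticAlgebra_re_mul]; simpa using hc.1
    · rw [quadraticAlgebra_im_mul]; simpa using hc.2

/-- The real factors g and k enter im z · im w · im(zw) only through (gk)², so the reduced formula
carries over. -/
theorem indSide_mul_of_reducesTo {e : ℚ} (he : e * e = 1) {z w : QuadraticAlgebra R[X] (-1) 0}
    {x : R} {v u : Cx R} (h : ReducesTo z x v) (h' : ReducesTo w x u) :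
    indSide e (z * w).re (z * w).im x - indSide e z.re z.im x - indSide e w.re w.im x +
      1 / 2 * germSign e (z.im * w.im * (z * w).im) x = 1 / 2 * sgn (v.im * u.im * (v * u).im) := by
  obtain ⟨g, p, q, hg, rfl, rfl, hpq⟩ := h
  obtain ⟨k, r, s, hk, rfl, rfl, hrs⟩ := h'
  have h1 := indSide_mul he hpq hrs
  simp only [quadraticAlgebra_re_mul, quadraticAlgebra_im_mul]
  have e1 : g * p * (k * r) - g * q * (k * s) = g * k * (p * r - q * s) := by ring
  have e2 : g * p * (k * s) + g * q * (k * r) = g * k * (p * s + q * r) := by ring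
  rw [e1, e2, indSide_mul_left e (mul_ne_zero hg hk), indSide_mul_left e hg, indSide_mul_left e hk,
    ← h1]
  simp only [germSign_mul]
  have h2 := germSign_sq he hg x
  have h3 := germSign_sq he hk x
  linear_combination (1 / 2) * germSign e q x * germSign e s x * germSign e (p * s + q * r) x *
    (h2 + germSign e g x ^ 2 * h3)

theorem indSide_add_inv {e : ℚ} (he : e * e = 1) (z : QuadraticAlgebra R[X] (-1) 0) (x : R) :
    indSide e z.re z.im x + indSide e (-z.im) z.re x = indSide e (z * z).re (z * z).im x := by
  by_cases hz : z = 0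
  · subst hz; simp [indSide_zero_left]
  obtain ⟨v, g, p, q, hg, rfl, rfl, hpq⟩ := exists_reducesTo hz x
  simp only [quadraticAlgebra_re_mul, quadraticAlgebra_im_mul]
  have e1 : g * p * (g * p) - g * q * (g * q) = g * g * (p * p - q * q) := by ring
  have e2 : g * p * (g * q) + g * q * (g * p) = g * g * (p * q + q * p) := by ring
  rw [e1, e2, indSide_mul_left e (mul_ne_zero hg hg), indSide_mul_left e hg, ← mul_neg,
    indSide_mul_left e hg]
  exact indSide_add_inv_of_reduced he hpq

/-- The Cauchy index of the square of `z` on `[a, b]`: four times the contribution of an edge to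
the new winding number. -/
noncomputable def edgeIndex (z : QuadraticAlgebra R[X] (-1) 0) (a b : R) : ℚ :=
  indLT (z * z).re (z * z).im a b

theorem indLT_add_inv (z : QuadraticAlgebra R[X] (-1) 0) (a b : R) :
    indLT z.re z.im a b + indLT (-z.im) z.re a b = edgeIndex z a b := by
  rw [edgeIndex, indLT_eq_sideSum, indLT_eq_sideSum, indLT_eq_sideSum,
    ← sideSum_add (finite_support_indSide _ _) (finite_support_indSide _ _)]
  congr 1 <;> ext x
  · exact indSide_add_inv (by norm_num) z x
  · exact indSide_add_inv (by norm_num) z x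

theorem finite_support_smul (c : ℚ) {f g : R → ℚ} (h : (Function.support (f - g)).Finite) :
    (Function.support (c • f - c • g)).Finite := by
  rw [← smul_sub]
  exact h.subset (Function.support_const_smul_subset c _)

theorem finite_support_add {f g f' g' : R → ℚ} (h : (Function.support (f - g)).Finite)
    (h' : (Function.support (f' - g')).Finite) :
    (Function.support (f + f' - (g + g'))).Finite := by
  rw [add_sub_add_comm]
  exact (h.union h').subset (Function.support_add _ _)

variable [IsRealClosed R]

/-- The product formula for the Cauchy index on an interval. -/
theorem indLT_mul {z w : QuadraticAlgebra R[X] (-1) 0} {a b : R} (hab : a < b)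
    {va ua vb ub : Cx R} (hza : ReducesTo z a va) (hwa : ReducesTo w a ua)
    (hzb : ReducesTo z b vb) (hwb : ReducesTo w b ub) :
    indLT (z * w).re (z * w).im a b = indLT z.re z.im a b + indLT w.re w.im a b +
      1 / 2 * sgn (va.im * ua.im * (va * ua).im) - 1 / 2 * sgn (vb.im * ub.im * (vb * ub).im) := by
  -- The left side of the local product formula. It does not depend on e, so its `sideSum` collapses
  -- to the two endpoint values.
  let D : ℚ → R → ℚ := fun e => (indSide e (z * w).re (z * w).im +
    (-1 : ℚ) • indSide e z.re z.im) + ((-1 : ℚ) • indSide e w.re w.im +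
      (1 / 2 : ℚ) • germSign e (z.im * w.im * (z * w).im))
  have hD : ∀ {e : ℚ}, e * e = 1 → ∀ {x : R} {v u : Cx R}, ReducesTo z x v → ReducesTo w x u →
      D e x = 1 / 2 * sgn (v.im * u.im * (v * u).im) := by
    intro e he x v u hv hu
    rw [← indSide_mul_of_reducesTo he hv hu]
    simp only [D, Pi.add_apply, Pi.smul_apply, smul_eq_mul]
    ring
  have hDD : D (-1) = D 1 := by
    ext x
    obtain ⟨v, hv⟩ := exists_reducesTo hza.ne_zero x
    obtain ⟨u, hu⟩ := exists_reducesTo hwa.ne_zero x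
    rw [hD (by norm_num) hv hu, hD (by norm_num) hv hu]
  have h1 : sideSum (D 1) (D (-1)) a b = D 1 a - D 1 b := by rw [hDD, sideSum_self]
  have f1 := finite_support_indSide (z * w).re (z * w).im
  have f2 := finite_support_smul (-1) (finite_support_indSide z.re z.im)
  have f3 := finite_support_smul (-1) (finite_support_indSide w.re w.im)
  have f4 := finite_support_smul (1 / 2) (finite_support_germSign (z.im * w.im * (z * w).im))
  rw [hD (by norm_num) hza hwa, hD (by norm_num) hzb hwb,
    sideSum_add (finite_support_add f1 f2) (finite_support_add f3 f4), sideSum_add f1 f2,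
    sideSum_add f3 f4, sideSum_smul, sideSum_smul, sideSum_smul, sideSum_germSign _ hab,
    ← indLT_eq_sideSum, ← indLT_eq_sideSum, ← indLT_eq_sideSum] at h1
  linear_combination h1

end Edge

end RectWinding

namespace RectWinding

/-! ### Vertices, and the index of a linear factor on an edge -/

section Corner

open Polynomial

variable {R : Type*} [Field R] [LinearOrder R] [IsStrictOrderedRing R]

/-- The reduced values of `z` at `x` and of `w` at `y` agree up to a real factor and a power of
`i`. -/
def CornerCompatible (z : QuadraticAlgebra R[X] (-1) 0) (x : R)
    (w : QuadraticAlgebra R[X] (-1) 0) (y : R) : Prop :=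
  ∃ (v u : Cx R) (r : R), r ≠ 0 ∧ ReducesTo z x v ∧ ReducesTo w y u ∧ u * u = r • (v * v)

/-- The correction term in the product formula for `edgeIndex`. -/
def corrTerm (v u : Cx R) : ℚ := 1 / 2 * sgn ((v * v).im * (u * u).im * (v * v * (u * u)).im)

/-- Scaling the two squares by r and s multiplies the triple product by (rs)² > 0. -/
theorem corrTerm_congr {v u v' u' : Cx R} {r s : R} (hr : r ≠ 0) (hs : s ≠ 0)
    (h : v' * v' = r • (v * v)) (h' : u' * u' = s • (u * u)) :
    corrTerm v' u' = corrTerm v u := by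
  have e1 : (v' * v').im * (u' * u').im * (v' * v' * (u' * u')).im =
      (r * s) * (r * s) * ((v * v).im * (u * u).im * (v * v * (u * u)).im) := by
    rw [h, h', smul_mul_smul_comm]
    simp only [QuadraticAlgebra.im_smul, smul_eq_mul]
    ring
  rw [corrTerm, e1, sgn_mul, sgn_of_pos (mul_self_pos.2 (mul_ne_zero hr hs)), one_mul, corrTerm]

theorem CornerCompatible.mul {z w z' w' : QuadraticAlgebra R[X] (-1) 0} {x y : R}
    (h : CornerCompatible z x w y) (h' : CornerCompatible z' x w' y) :
    CornerCompatible (z * z') x (w * w') y := by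
  obtain ⟨v, u, r, hr, hv, hu, hvu⟩ := h
  obtain ⟨v', u', r', hr', hv', hu', hvu'⟩ := h'
  refine ⟨v * v', u * u', r * r', mul_ne_zero hr hr', hv.mul hv', hu.mul hu', ?_⟩
  rw [mul_mul_mul_comm, hvu, hvu', smul_mul_smul_comm, mul_mul_mul_comm v]

theorem ReducesTo.star {z : QuadraticAlgebra R[X] (-1) 0} {x : R} {v : Cx R}
    (h : ReducesTo z x v) : ReducesTo (star z) x (star v) := by
  obtain ⟨g, p, q, hg, rfl, rfl, hpq⟩ := h
  exact ⟨g, p, -q, hg, by ext1 <;> simp, by ext1 <;> simp, by simpa using hpq⟩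

theorem CornerCompatible.star {z w : QuadraticAlgebra R[X] (-1) 0} {x y : R}
    (h : CornerCompatible z x w y) : CornerCompatible (star z) x (star w) y := by
  obtain ⟨v, u, r, hr, hv, hu, hvu⟩ := h
  refine ⟨_, _, r, hr, hv.star, hu.star, ?_⟩
  rw [← star_mul, hvu, ← star_mul]
  ext1 <;> simp
  ring

theorem cornerCompatible_const {p q : R} (h : p ≠ 0 ∨ q ≠ 0) (x y : R) :
    CornerCompatible (⟨C p, C q⟩ : QuadraticAlgebra R[X] (-1) 0) x ⟨C p, C q⟩ y :=
  ⟨⟨p, q⟩, ⟨p, q⟩, 1, one_ne_zero, ⟨1, C p, C q, one_ne_zero, by simp, by simp, by simpa using h⟩,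
    ⟨1, C p, C q, one_ne_zero, by simp, by simp, by simpa using h⟩, by simp⟩

/-- Away from the zero both restrictions take the same value. At the zero they are T - x and i(T -
y), with reduced values 1 and i, whose squares differ by the factor -1. -/
theorem cornerCompatible_linear (x y a b : R) :
    CornerCompatible (⟨X - C x, C (b - y)⟩ : QuadraticAlgebra R[X] (-1) 0) a
      ⟨C (a - x), X - C y⟩ b := by
  by_cases h : a - x ≠ 0 ∨ b - y ≠ 0
  · exact ⟨⟨a - x, b - y⟩, ⟨a - x, b - y⟩, 1, one_ne_zero,
      ⟨1, X - C x, C (b - y), one_ne_zero, by simp, by simp, by simpa using h⟩,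
      ⟨1, C (a - x), X - C y, one_ne_zero, by simp, by simp, by simpa using h⟩, by simp⟩
  · obtain ⟨h1, h2⟩ : a - x = 0 ∧ b - y = 0 := by simpa [not_or] using h
    refine ⟨⟨1, 0⟩, ⟨0, 1⟩, -1, by simp, ⟨X - C x, 1, 0, X_sub_C_ne_zero x, ?_, by simp, by simp⟩,
      ⟨X - C y, 0, 1, X_sub_C_ne_zero y, ?_, by simp, by simp⟩, by ext1 <;> simp⟩
    · rw [h2]; simp
    · rw [h1]; simp

theorem edgeIndex_eq_zero_of_im_eq_zero {z : QuadraticAlgebra R[X] (-1) 0} (h : z.im = 0)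
    (a b : R) : edgeIndex z a b = 0 := by
  have : (z * z).im = 0 := by rw [quadraticAlgebra_im_mul, h]; simp
  rw [edgeIndex, this, indLT_eq_sideSum]
  simp [sideSum, indSide_zero_right]

theorem edgeIndex_const (p q a b : R) :
    edgeIndex (⟨C p, C q⟩ : QuadraticAlgebra R[X] (-1) 0) a b = 0 := by
  have h : ∀ (e : ℚ) (c d x : R), indSide e (C c) (C d) x = 0 := by
    intro e c d x
    simp [indSide, valAt]
  have h1 : ((⟨C p, C q⟩ : QuadraticAlgebra R[X] (-1) 0) * ⟨C p, C q⟩).re =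
      C (p * p - q * q) := by rw [quadraticAlgebra_re_mul]; simp
  have h2 : ((⟨C p, C q⟩ : QuadraticAlgebra R[X] (-1) 0) * ⟨C p, C q⟩).im =
      C (p * q + q * p) := by rw [quadraticAlgebra_im_mul]; simp
  rw [edgeIndex, h1, h2, indLT_eq_sideSum]
  simp only [sideSum, h, sub_zero, finsum_mem_zero, add_zero]

/-- For k ≠ 0 the only pole is simple, at x. The difference of signs is 2, 1 or 0 according as x is
inside, at an end or outside; for k = 0 both sides vanish. -/
theorem indLT_linear {p : R[X]} {k x : R} (h : k ≠ 0 → p.eval x ≠ 0) {a b : R} (hab : a < b) :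
    indLT p (C k * (X - C x)) a b =
      1 / 2 * sgn (p.eval x) * sgn k * (sgn (b - x) - sgn (a - x)) := by
  by_cases hk : k = 0
  · subst hk
    rw [indLT_eq_sideSum]
    simp [sideSum, indSide_zero_right, sgn_zero]
  have hp := h hk
  have key : ∀ {e : ℚ}, e * e = 1 → ∀ t, indSide e p (C k * (X - C x)) t =
      if t = x then 1 / 2 * sgn (p.eval x) * sgn k * e else 0 := by
    intro e he t
    have hiff : (C k * (X - C x)).eval t = 0 ↔ t = x := by simp [hk, sub_eq_zero]
    have hred : p.eval t ≠ 0 ∨ (C k * (X - C x)).eval t ≠ 0 := by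
      by_cases ht : t = x
      · subst ht; exact Or.inl hp
      · exact Or.inr (mt hiff.1 ht)
    rw [indSide_eq_ite he hred]
    simp only [hiff]
    split_ifs with ht
    · subst ht
      rw [germSign_mul, germSign_X_sub_C, germSign_of_eval_ne_zero (by simpa using hk), eval_C]
      ring
    · rfl
  have hsum : ∑ᶠ t ∈ Set.Ioo a b, (indSide 1 p (C k * (X - C x)) t -
      indSide (-1) p (C k * (X - C x)) t) =
      if x ∈ Set.Ioo a b then sgn (p.eval x) * sgn k else 0 := by
    split_ifs with hx
    · rw [finsum_mem_def, finsum_eq_single _ x, Set.indicator_of_mem hx, key (by norm_num),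
        key (by norm_num), if_pos rfl, if_pos rfl]
      · ring
      · intro t ht
        refine Set.indicator_apply_eq_zero.2 fun _ => ?_
        rw [key (by norm_num), key (by norm_num), if_neg ht, if_neg ht, sub_zero]
    · refine finsum_mem_eq_zero_of_forall_eq_zero fun t ht => ?_
      have : t ≠ x := by rintro rfl; exact hx ht
      rw [key (by norm_num), key (by norm_num), if_neg this, if_neg this, sub_zero]
  rw [indLT_eq_sideSum, sideSum, hsum, key (by norm_num), key (by norm_num)]
  rcases lt_trichotomy x a with hx | rfl | hx
  · have hb : x < b := hx.trans hab
    rw [if_neg hx.ne', if_neg (fun h => hx.not_gt h.1), if_neg hb.ne', sgn_of_pos (sub_pos.2 hx),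
      sgn_of_pos (sub_pos.2 hb)]
    ring
  · rw [if_pos rfl, if_neg (fun h => h.1.false), if_neg hab.ne', sub_self, sgn_zero,
      sgn_of_pos (sub_pos.2 hab)]
    ring
  · rw [if_neg hx.ne, sgn_of_neg (sub_neg.2 hx)]
    rcases lt_trichotomy x b with hb | rfl | hb
    · rw [if_pos ⟨hx, hb⟩, if_neg hb.ne', sgn_of_pos (sub_pos.2 hb)]; ring
    · rw [if_neg (fun h => h.2.false), if_pos rfl, sub_self, sgn_zero]; ring
    · rw [if_neg (fun h => hb.not_gt h.2), if_neg hb.ne, sgn_of_neg (sub_neg.2 hb)]; ring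

/-- The square of (T - x) + ic has imaginary part 2c(T - x), and its real part at x is -c². -/
theorem edgeIndex_hor (x c : R) {a b : R} (hab : a < b) :
    edgeIndex (⟨X - C x, C c⟩ : QuadraticAlgebra R[X] (-1) 0) a b =
      -(1 / 2) * sgn c * (sgn (b - x) - sgn (a - x)) := by
  have h2 : ((⟨X - C x, C c⟩ : QuadraticAlgebra R[X] (-1) 0) * ⟨X - C x, C c⟩).im =
      C (2 * c) * (X - C x) := by
    rw [quadraticAlgebra_im_mul, C_mul, C_ofNat]; ring
  have h1 : ((⟨X - C x, C c⟩ : QuadraticAlgebra R[X] (-1) 0) * ⟨X - C x, C c⟩).re.eval x =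
      -(c * c) := by rw [quadraticAlgebra_re_mul]; simp
  rw [edgeIndex, h2, indLT_linear _ hab, h1, sgn_neg, sgn_mul c c, sgn_mul 2 c,
    sgn_of_pos (two_pos (α := R))]
  · by_cases hc : c = 0
    · simp [hc, sgn_zero]
    · rw [sgn_mul_self hc]; ring
  · intro hc
    rw [h1]
    simpa using hc

theorem edgeIndex_vert (y d : R) {a b : R} (hab : a < b) :
    edgeIndex (⟨C d, X - C y⟩ : QuadraticAlgebra R[X] (-1) 0) a b =
      1 / 2 * sgn d * (sgn (b - y) - sgn (a - y)) := by
  have h2 : ((⟨C d, X - C y⟩ : QuadraticAlgebra R[X] (-1) 0) * ⟨C d, X - C y⟩).im =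
      C (2 * d) * (X - C y) := by
    rw [quadraticAlgebra_im_mul, C_mul, C_ofNat]; ring
  have h1 : ((⟨C d, X - C y⟩ : QuadraticAlgebra R[X] (-1) 0) * ⟨C d, X - C y⟩).re.eval y =
      d * d := by rw [quadraticAlgebra_re_mul]; simp
  rw [edgeIndex, h2, indLT_linear _ hab, h1, sgn_mul d d, sgn_mul 2 d,
    sgn_of_pos (two_pos (α := R))]
  · by_cases hd : d = 0
    · simp [hd, sgn_zero]
    · rw [sgn_mul_self hd]; ring
  · intro hd
    rw [h1]
    simpa using hd

variable [IsRealClosed R]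

theorem edgeIndex_mul {z w : QuadraticAlgebra R[X] (-1) 0} {a b : R} (hab : a < b)
    {va ua vb ub : Cx R} (hza : ReducesTo z a va) (hwa : ReducesTo w a ua)
    (hzb : ReducesTo z b vb) (hwb : ReducesTo w b ub) :
    edgeIndex (z * w) a b = edgeIndex z a b + edgeIndex w a b + corrTerm va ua -
      corrTerm vb ub := by
  rw [edgeIndex, mul_mul_mul_comm, indLT_mul hab (hza.mul hza) (hwa.mul hwa) (hzb.mul hzb)
    (hwb.mul hwb)]
  rfl

end Corner

end RectWinding

namespace RectWinding

/-! ### Restriction to lines as a ring homomorphism -/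

section PointHom

open Polynomial

variable {R : Type*} [Field R]

/-- The inclusion of `C = R[i]` in `R[T][i]`. -/
noncomputable def cxConst : Cx R →+* QuadraticAlgebra R[X] (-1) 0 where
  toFun z := ⟨C z.re, C z.im⟩
  map_one' := QuadraticAlgebra.ext C_1 C_0
  map_zero' := by ext1 <;> simp
  map_add' z w := by ext1 <;> simp
  map_mul' z w := by ext1 <;> simp

/-- Substitution of real polynomials for the two variables of a complex polynomial. -/
noncomputable def substHom (v : Fin 2 → R[X]) :
    MvPolynomial (Fin 2) (Cx R) →+* QuadraticAlgebra R[X] (-1) 0 :=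
  MvPolynomial.eval₂Hom cxConst fun i => ⟨v i, 0⟩

theorem substHom_map (v : Fin 2 → R[X]) (P : MvPolynomial (Fin 2) R) :
    substHom v (MvPolynomial.map (algebraMap R (Cx R)) P) = ⟨MvPolynomial.aeval v P, 0⟩ := by
  have h : (substHom v).comp (MvPolynomial.map (algebraMap R (Cx R))) =
      (algebraMap R[X] (QuadraticAlgebra R[X] (-1) 0)).comp
        (MvPolynomial.aeval v : MvPolynomial (Fin 2) R →ₐ[R] R[X]).toRingHom := by
    refine MvPolynomial.ringHom_ext (fun r => ?_) fun i => ?_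
    · simp [substHom, cxConst, QuadraticAlgebra.algebraMap_eq]
    · simp [substHom, QuadraticAlgebra.algebraMap_eq]
  exact RingHom.congr_fun h P

theorem substHom_C_imUnit (v : Fin 2 → R[X]) :
    substHom v (MvPolynomial.C imUnit) = ⟨0, 1⟩ := by
  simp [substHom, cxConst, imUnit]

theorem substHom_apply (v : Fin 2 → R[X]) (F : MvPolynomial (Fin 2) (Cx R)) :
    substHom v F = ⟨MvPolynomial.aeval v (rePart F), MvPolynomial.aeval v (imPart F)⟩ := by
  conv_lhs => rw [eq_rePart_add_imPart F]
  rw [map_add, map_mul, substHom_map, substHom_map, substHom_C_imUnit]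
  ext1 <;> simp

theorem substHom_conj (v : Fin 2 → R[X]) (F : MvPolynomial (Fin 2) (Cx R)) :
    substHom v (conj F) = star (substHom v F) := by
  rw [substHom_apply v F, conj, map_sub, map_mul, substHom_map, substHom_map, substHom_C_imUnit]
  ext1 <;> simp

theorem substHom_inclZ_X_sub_C (v : Fin 2 → R[X]) (z : Cx R) :
    substHom v (inclZ (X - C z)) = ⟨v 0 - C z.re, v 1 - C z.im⟩ := by
  simp only [inclZ, map_sub, aeval_X, aeval_C, map_add, map_mul, substHom_C_imUnit]
  ext1 <;> simp [substHom, cxConst, MvPolynomial.algebraMap_eq]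

theorem substHom_inclZ_C (v : Fin 2 → R[X]) (z : Cx R) :
    substHom v (inclZ (C z)) = ⟨C z.re, C z.im⟩ := by
  simp [inclZ, substHom, cxConst, MvPolynomial.algebraMap_eq]

end PointHom

/-! ### The index along the boundary -/

section Boundary

open Polynomial

variable {R : Type*} [Field R] [LinearOrder R] [IsStrictOrderedRing R]

/-- The restriction of a complex polynomial to the horizontal line at height `y`. -/
noncomputable def horHom (y : R) :
    MvPolynomial (Fin 2) (Cx R) →+* QuadraticAlgebra R[X] (-1) 0 :=
  substHom ![X, C y]

/-- The restriction of a complex polynomial to the vertical line at abscissa `x`. -/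
noncomputable def vertHom (x : R) :
    MvPolynomial (Fin 2) (Cx R) →+* QuadraticAlgebra R[X] (-1) 0 :=
  substHom ![C x, X]

/-- Four times the new winding number. -/
noncomputable def boundaryIndex (Γ : Rectangle R) (F : MvPolynomial (Fin 2) (Cx R)) : ℚ :=
  edgeIndex (horHom Γ.y₀ F) Γ.x₀ Γ.x₁ + edgeIndex (vertHom Γ.x₁ F) Γ.y₀ Γ.y₁ -
    edgeIndex (horHom Γ.y₁ F) Γ.x₀ Γ.x₁ - edgeIndex (vertHom Γ.x₀ F) Γ.y₀ Γ.y₁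

theorem ind_of_lt (P Q : R[X]) {a b : R} (h : a < b) : ind P Q a b = indLT P Q a b := by
  simp [ind, h]

theorem ind_of_gt (P Q : R[X]) {a b : R} (h : a < b) : ind P Q b a = -indLT P Q a b := by
  simp [ind, h, h.not_gt]

theorem windNew_eq_boundaryIndex (F : MvPolynomial (Fin 2) (Cx R)) (Γ : Rectangle R) :
    windNew F Γ = 1 / 4 * boundaryIndex Γ F := by
  have h1 : rePart (MvPolynomial.C imUnit * F) = -imPart F := by
    ext m; simp [coeff_rePart, coeff_imPart, MvPolynomial.coeff_C_mul, imUnit]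
  have h2 : imPart (MvPolynomial.C imUnit * F) = rePart F := by
    ext m; simp [coeff_rePart, coeff_imPart, MvPolynomial.coeff_C_mul, imUnit]
  have hx := Γ.x_lt
  have hy := Γ.y_lt
  simp only [windNew, windOld, h1, h2, boundaryIndex, ← indLT_add_inv, horHom, vertHom,
    substHom_apply, ind_of_lt _ _ hx, ind_of_lt _ _ hy, ind_of_gt _ _ hx, ind_of_gt _ _ hy,
    restrictHor, restrictVert, map_neg]
  ring

/-- At each vertex of `Γ`, the restrictions of `F` to the two adjacent edges are compatible. -/
def CompatibleAtVertices (Γ : Rectangle R) (F : MvPolynomial (Fin 2) (Cx R)) : Prop :=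
  ∀ x y, (x = Γ.x₀ ∨ x = Γ.x₁) → (y = Γ.y₀ ∨ y = Γ.y₁) →
    CornerCompatible (horHom y F) x (vertHom x F) y

theorem CompatibleAtVertices.mul {Γ : Rectangle R} {F G : MvPolynomial (Fin 2) (Cx R)}
    (hF : CompatibleAtVertices Γ F) (hG : CompatibleAtVertices Γ G) :
    CompatibleAtVertices Γ (F * G) := by
  intro x y hx hy
  rw [map_mul, map_mul]
  exact (hF x y hx hy).mul (hG x y hx hy)

theorem CompatibleAtVertices.conj {Γ : Rectangle R} {F : MvPolynomial (Fin 2) (Cx R)}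
    (hF : CompatibleAtVertices Γ F) : CompatibleAtVertices Γ (conj F) := by
  intro x y hx hy
  rw [horHom, vertHom, substHom_conj, substHom_conj]
  exact (hF x y hx hy).star

theorem compatibleAtVertices_C (Γ : Rectangle R) {c : Cx R} (hc : c ≠ 0) :
    CompatibleAtVertices Γ (inclZ (C c)) := by
  intro x y _ _
  rw [horHom, vertHom, substHom_inclZ_C, substHom_inclZ_C]
  refine cornerCompatible_const ?_ x y
  by_contra! h
  exact hc (QuadraticAlgebra.ext h.1 h.2)

theorem compatibleAtVertices_X_sub_C (Γ : Rectangle R) (z : Cx R) :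
    CompatibleAtVertices Γ (inclZ (X - C z)) := by
  intro x y _ _
  rw [horHom, vertHom, substHom_inclZ_X_sub_C, substHom_inclZ_X_sub_C]
  simpa using cornerCompatible_linear z.re z.im x y

theorem boundaryIndex_C (Γ : Rectangle R) (c : Cx R) : boundaryIndex Γ (inclZ (C c)) = 0 := by
  simp [boundaryIndex, horHom, vertHom, substHom_inclZ_C, edgeIndex_const]

theorem sgn_sub_sgn {a b x : R} (hab : a < b) :
    sgn (b - x) - sgn (a - x) =
      if a < x ∧ x < b then 2 else if x = a ∨ x = b then 1 else 0 := by
  rcases lt_trichotomy x a with hx | rfl | hx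
  · have hb : x < b := hx.trans hab
    rw [sgn_of_pos (sub_pos.2 hx), sgn_of_pos (sub_pos.2 hb), if_neg (fun h => hx.not_gt h.1),
      if_neg (not_or.2 ⟨hx.ne, hb.ne⟩), sub_self]
  · rw [sub_self, sgn_zero, sgn_of_pos (sub_pos.2 hab), if_neg (fun h => h.1.false),
      if_pos (Or.inl rfl), sub_zero]
  · rw [sgn_of_neg (sub_neg.2 hx)]
    rcases lt_trichotomy x b with hb | rfl | hb
    · rw [if_pos ⟨hx, hb⟩, sgn_of_pos (sub_pos.2 hb)]; norm_num
    · rw [sub_self, sgn_zero, if_neg (fun h => h.2.false), if_pos (Or.inr rfl)]; norm_num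
    · rw [sgn_of_neg (sub_neg.2 hb), if_neg (fun h => hb.not_gt h.2),
        if_neg (not_or.2 ⟨hx.ne', hb.ne'⟩), sub_self]

/-- The weight is a product of one-dimensional weights 1, 1/2 and 0, each half of a difference of
signs. -/
theorem weight_eq (Γ : Rectangle R) (z : Cx R) :
    4 * weight Γ z = (sgn (Γ.x₁ - z.re) - sgn (Γ.x₀ - z.re)) *
      (sgn (Γ.y₁ - z.im) - sgn (Γ.y₀ - z.im)) := by
  have hx := Γ.x_lt
  have hy := Γ.y_lt
  have key : ∀ {a b x : R}, ¬ (a < x ∧ x < b) → ¬ (x = a ∨ x = b) →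
      ¬ (a ≤ x ∧ x ≤ b) := by
    intro a b x h1 h2 h3
    rw [not_or] at h2
    exact h1 ⟨lt_of_le_of_ne h3.1 (Ne.symm h2.1), lt_of_le_of_ne h3.2 h2.2⟩
  have key' : ∀ {a b x : R}, a < b → (a < x ∧ x < b) ∨ (x = a ∨ x = b) → (a ≤ x ∧ x ≤ b) := by
    rintro a b x h (h1 | rfl | rfl)
    · exact ⟨h1.1.le, h1.2.le⟩
    · exact ⟨le_rfl, h.le⟩
    · exact ⟨h.le, le_rfl⟩
  have key'' : ∀ {a b x : R}, (a < x ∧ x < b) → ¬ (x = a ∨ x = b) := by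
    rintro a b x h (rfl | rfl)
    · exact h.1.false
    · exact h.2.false
  rw [sgn_sub_sgn hx, sgn_sub_sgn hy, weight]
  simp only [← and_assoc]
  simp only [and_assoc (a := Γ.x₀ < z.re ∧ z.re < Γ.x₁), and_assoc (a := Γ.x₀ ≤ z.re ∧ z.re ≤ Γ.x₁)]
  by_cases h1 : Γ.x₀ < z.re ∧ z.re < Γ.x₁ <;> by_cases h2 : Γ.y₀ < z.im ∧ z.im < Γ.y₁
  · rw [if_pos ⟨h1, h2⟩, if_pos h1, if_pos h2]; norm_num
  · rw [if_neg (fun h => h2 h.2), if_pos h1, if_neg h2, if_neg (fun h => key'' h1 h.1)]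
    by_cases h3 : z.im = Γ.y₀ ∨ z.im = Γ.y₁
    · rw [if_pos ⟨key' hx (Or.inl h1), key' hy (Or.inr h3)⟩, if_pos h3]; norm_num
    · rw [if_neg (fun h => key h2 h3 h.2), if_neg h3]; norm_num
  · rw [if_neg (fun h => h1 h.1), if_neg h1, if_pos h2, if_neg (fun h => key'' h2 h.2)]
    by_cases h3 : z.re = Γ.x₀ ∨ z.re = Γ.x₁
    · rw [if_pos ⟨key' hx (Or.inr h3), key' hy (Or.inl h2)⟩, if_pos h3]; norm_num
    · rw [if_neg (fun h => key h1 h3 h.1), if_neg h3]; norm_num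
  · rw [if_neg (fun h => h1 h.1), if_neg h1, if_neg h2]
    by_cases h3 : z.re = Γ.x₀ ∨ z.re = Γ.x₁ <;> by_cases h4 : z.im = Γ.y₀ ∨ z.im = Γ.y₁
    · rw [if_pos ⟨h3, h4⟩, if_pos h3, if_pos h4]; norm_num
    · rw [if_neg (fun h => h4 h.2), if_neg (fun h => key h2 h4 h.2), if_neg h4]; norm_num
    · rw [if_neg (fun h => h3 h.1), if_neg (fun h => key h1 h3 h.1), if_neg h3]; norm_num
    · rw [if_neg (fun h => h3 h.1), if_neg (fun h => key h1 h3 h.1), if_neg h3]; norm_num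

/-- The horizontal pair of edges and the vertical pair each contribute half of the product in
`weight_eq`. -/
theorem boundaryIndex_X_sub_C (Γ : Rectangle R) (z : Cx R) :
    boundaryIndex Γ (inclZ (X - C z)) = 4 * weight Γ z := by
  have h : ∀ y : R, horHom y (inclZ (X - C z)) = ⟨X - C z.re, C (y - z.im)⟩ := by
    intro y; rw [horHom, substHom_inclZ_X_sub_C]; simp
  have h' : ∀ x : R, vertHom x (inclZ (X - C z)) = ⟨C (x - z.re), X - C z.im⟩ := by
    intro y; rw [vertHom, substHom_inclZ_X_sub_C]; simp
  rw [weight_eq, boundaryIndex, h, h, h', h', edgeIndex_hor _ _ Γ.x_lt, edgeIndex_hor _ _ Γ.x_lt,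
    edgeIndex_vert _ _ Γ.y_lt, edgeIndex_vert _ _ Γ.y_lt]
  ring

variable [IsRealClosed R]

/-- Each vertex receives a correction from both adjacent edges, with opposite signs. Compatibility
makes the two equal, so all corrections cancel. -/
theorem boundaryIndex_mul {Γ : Rectangle R} {F G : MvPolynomial (Fin 2) (Cx R)}
    (hF : CompatibleAtVertices Γ F) (hG : CompatibleAtVertices Γ G) :
    boundaryIndex Γ (F * G) = boundaryIndex Γ F + boundaryIndex Γ G := by
  obtain ⟨v₁, u₁, r₁, hr₁, hv₁, hu₁, h₁⟩ := hF Γ.x₀ Γ.y₀ (.inl rfl) (.inl rfl)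
  obtain ⟨v₂, u₂, r₂, hr₂, hv₂, hu₂, h₂⟩ := hF Γ.x₁ Γ.y₀ (.inr rfl) (.inl rfl)
  obtain ⟨v₃, u₃, r₃, hr₃, hv₃, hu₃, h₃⟩ := hF Γ.x₁ Γ.y₁ (.inr rfl) (.inr rfl)
  obtain ⟨v₄, u₄, r₄, hr₄, hv₄, hu₄, h₄⟩ := hF Γ.x₀ Γ.y₁ (.inl rfl) (.inr rfl)
  obtain ⟨v₁', u₁', r₁', hr₁', hv₁', hu₁', h₁'⟩ := hG Γ.x₀ Γ.y₀ (.inl rfl) (.inl rfl)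
  obtain ⟨v₂', u₂', r₂', hr₂', hv₂', hu₂', h₂'⟩ := hG Γ.x₁ Γ.y₀ (.inr rfl) (.inl rfl)
  obtain ⟨v₃', u₃', r₃', hr₃', hv₃', hu₃', h₃'⟩ := hG Γ.x₁ Γ.y₁ (.inr rfl) (.inr rfl)
  obtain ⟨v₄', u₄', r₄', hr₄', hv₄', hu₄', h₄'⟩ := hG Γ.x₀ Γ.y₁ (.inl rfl) (.inr rfl)
  have c₁ := corrTerm_congr hr₁ hr₁' h₁ h₁'
  have c₂ := corrTerm_congr hr₂ hr₂' h₂ h₂'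
  have c₃ := corrTerm_congr hr₃ hr₃' h₃ h₃'
  have c₄ := corrTerm_congr hr₄ hr₄' h₄ h₄'
  simp only [boundaryIndex, map_mul]
  rw [edgeIndex_mul Γ.x_lt hv₁ hv₁' hv₂ hv₂', edgeIndex_mul Γ.x_lt hv₄ hv₄' hv₃ hv₃',
    edgeIndex_mul Γ.y_lt hu₂ hu₂' hu₃ hu₃', edgeIndex_mul Γ.y_lt hu₁ hu₁' hu₄ hu₄',
    c₁, c₂, c₃, c₄]
  ring

/-- F times its conjugate is real on every edge, so its index is 0. -/
theorem boundaryIndex_conj {Γ : Rectangle R} {F : MvPolynomial (Fin 2) (Cx R)}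
    (hF : CompatibleAtVertices Γ F) : boundaryIndex Γ (conj F) = -boundaryIndex Γ F := by
  have h : ∀ v, (substHom v (F * conj F)).im = 0 := by
    intro v
    rw [map_mul, substHom_conj, quadraticAlgebra_im_mul]
    simp; ring
  have h0 : boundaryIndex Γ (F * conj F) = 0 := by
    simp only [boundaryIndex, horHom, vertHom, edgeIndex_eq_zero_of_im_eq_zero (h _), add_zero,
      sub_zero]
  rw [boundaryIndex_mul hF hF.conj] at h0
  linear_combination h0

theorem inclZ_mul (F G : (Cx R)[X]) : inclZ (F * G) = inclZ F * inclZ G := map_mul _ F G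

/-- The argument principle for polynomials in `C[Z]`. -/
theorem boundaryIndex_inclZ (Γ : Rectangle R) {F : (Cx R)[X]} (hF : F ≠ 0) :
    CompatibleAtVertices Γ (inclZ F) ∧
      boundaryIndex Γ (inclZ F) = 4 * (F.roots.map (weight Γ)).sum := by
  have := isAlgClosed_cx (R := R)
  -- Compatibility is carried through the induction because additivity requires it of each factor.
  have hprod : ∀ s : Multiset (Cx R),
      CompatibleAtVertices Γ (inclZ (s.map fun a => X - C a).prod) ∧
      boundaryIndex Γ (inclZ (s.map fun a => X - C a).prod) = 4 * (s.map (weight Γ)).sum := by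
    intro s
    induction s using Multiset.induction_on with
    | empty =>
      rw [Multiset.map_zero, Multiset.prod_zero, ← C_1]
      exact ⟨compatibleAtVertices_C Γ one_ne_zero, by simp [-map_one, boundaryIndex_C]⟩
    | cons a s ih =>
      rw [Multiset.map_cons, Multiset.prod_cons, inclZ_mul, Multiset.map_cons, Multiset.sum_cons,
        boundaryIndex_mul (compatibleAtVertices_X_sub_C Γ a) ih.1, ih.2, boundaryIndex_X_sub_C]
      exact ⟨(compatibleAtVertices_X_sub_C Γ a).mul ih.1, by ring⟩
  have hc := compatibleAtVertices_C Γ (leadingCoeff_ne_zero.2 hF)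
  have hs := hprod F.roots
  have hF' := (IsAlgClosed.splits F).eq_prod_roots
  have h1 : inclZ F = inclZ (C F.leadingCoeff) * inclZ (F.roots.map fun a => X - C a).prod := by
    rw [← inclZ_mul, ← hF']
  rw [h1, boundaryIndex_mul hc hs.1, boundaryIndex_C, hs.2, zero_add]
  exact ⟨hc.mul hs.1, rfl⟩

end Boundary

end RectWinding

theorem theorem1p3 {R : Type*} [Field R] [LinearOrder R] [IsStrictOrderedRing R] [IsRealClosed R]
    (f : RatFunc (RectWinding.Cx R)) (hf : f ≠ 0)
    (F G : Polynomial (RectWinding.Cx R)) (hG : G ≠ 0)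
    (hFG : f = algebraMap (Polynomial (RectWinding.Cx R)) (RatFunc (RectWinding.Cx R)) F /
      algebraMap (Polynomial (RectWinding.Cx R)) (RatFunc (RectWinding.Cx R)) G)
    (Γ : RectWinding.Rectangle R) :
    RectWinding.windNewQuot (RectWinding.inclZ F) (RectWinding.inclZ G) Γ =
      RectWinding.zerosIn f Γ - RectWinding.polesIn f Γ := by
  have hF : F ≠ 0 := by
    rintro rfl
    exact hf (by simpa using hFG)
  have hmul : F * f.denom = f.num * G := by
    have h := hFG
    rw [← RatFunc.num_div_denom f, div_eq_div_iff
      (by simpa using RatFunc.denom_ne_zero f) (by simpa using hG), ← map_mul, ← map_mul] at h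
    exact (RatFunc.algebraMap_injective _ h).symm
  -- Comparing root multisets after cross-multiplication cancels the common factors of F and G.
  have hroots : F.roots + f.denom.roots = f.num.roots + G.roots := by
    rw [← Polynomial.roots_mul (mul_ne_zero hF (RatFunc.denom_ne_zero f)), hmul,
      Polynomial.roots_mul (mul_ne_zero (RatFunc.num_ne_zero hf) hG)]
  have hsum := congrArg (fun s => (s.map (RectWinding.weight Γ)).sum) hroots
  simp only [Multiset.map_add, Multiset.sum_add] at hsum
  obtain ⟨h1, h2⟩ := RectWinding.boundaryIndex_inclZ Γ hF
  obtain ⟨h3, h4⟩ := RectWinding.boundaryIndex_inclZ Γ hG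
  rw [RectWinding.windNewQuot, RectWinding.windNew_eq_boundaryIndex,
    RectWinding.boundaryIndex_mul h1 h3.conj, RectWinding.boundaryIndex_conj h3, h2, h4,
    RectWinding.zerosIn, RectWinding.polesIn]
  linear_combination hsum
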